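/- Let $\mathcal A,\mathcal A'$ be abelian categories with hereditary abelian model structures $\mathfrak M=(\mathcal Q,\mathcal W,\mathcal R)$ and $\mathfrak M'=(\mathcal Q',\mathcal W',\mathcal R')$: $\mathcal W$ satisfies 2-out-of-3 on short exact sequences, $(\mathcal Q,\mathcal W\cap\mathcal R)$ and $(\mathcal Q\cap\mathcal W,\mathcal R)$ are complete cotorsion pairs, and they are hereditary, i.e. $\mathrm{Ext}^i(X,Y)=0$ for all $i\ge 1$ and all $X$ in the left class, $Y$ in the right class of the pair; similarly for $\mathfrak M'$. Let $-\otimes-:\mathcal A\times\mathcal A'\to\mathbf{Ab}$ be a bifunctor that is additive and right exact in each variable, and suppose that every trivially cofibrant object $A\in\mathcal Q\cap\mathcal W$ is flat ($A\otimes-$ is exact) and every $B\in\mathcal Q'\cap\mathcal W'$ is flat ($-\otimes B$ is exact). A cofibrant replacement $QA$ of $A$ is the middle term of a short exact sequence $0\to K\to QA\to A\to 0$ with $QA\in\mathcal Q$, $K\in\mathcal W\cap\mathcal R$; a fibrant replacement $RA$ is the middle term of a short exact sequence $0\to A\to RA\to C\to 0$ with $RA\in\mathcal R$, $C\in\mathcal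 Q\cap\mathcal W$; $RQA$ is a fibrant replacement of a cofibrant replacement of $A$. An $\mathfrak M$-resolution $W_A$ of $A$ is an exact chain complex indexed by $\mathbb Z$ obtained by splicing, through $d_0=\eta\varepsilon$, an exact complex $\cdots\to W_1\to W_0\xrightarrow{\varepsilon}A\to0$ with all $W_n\in\mathcal Q\cap\mathcal W$ and all kernels in $\mathcal R$, and an exact complex $0\to A\xrightarrow{\eta}W_{-1}\to W_{-2}\to\cdots$ with all $W_n\in\mathcal W\cap\mathcal R$ and all cokernels in $\mathcal Q$. For cofibrant $A$ and $B$, $\mathrm{Tor}_n^{\mathfrak M}(A,B)$ is the group $H_n(W_A\otimes B)\cong H_n(A\otimes W_B)$ ($n\in\mathbb Z$), where $W_A$ is an $\mathfrak M$-resolution of $A$ and $W_B$ is an $\mathfrak M'$-resolution of $B$. The homotopy category $\mathrm{Ho}(\mathfrak M)$ has the objects of $\mathcal A$, and its morphisms $A\to B$ are the morphisms $RQA\to RQB$ modulo those that factor through an object of $\mathcal Q\cap\mathcal W\cap\mathcal R$; $\gamma:\mathcal A\to\mathrm{Ho}(\mathfrak M)$ is the identity on objects and sends $f$ to the class of $R(Q(f))$.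 $\mathrm{Ho}(\mathfrak M')$ and $\gamma'$ are defined in the same way. Theorem. For each $n\in\mathbb Z$, $\mathrm{Tor}_n^{\mathrm{Ho}(\mathfrak M)}(A,B):=\mathrm{Tor}_n^{\mathfrak M}(RQA,RQB)$ defines a bifunctor $\mathcal A\times\mathcal A'\to\mathbf{Ab}$: there is a bifunctor that is naturally isomorphic to $H_n(W_{RQA}\otimes RQB)$ and to $H_n(RQA\otimes W_{RQB})$ for all choices of replacements and resolutions and all choices of lifts of morphisms to them. Every such bifunctor has the following properties. 1. For each $A$, $\mathrm{Tor}_n^{\mathrm{Ho}(\mathfrak M)}(A,-):\mathcal A'\to\mathbf{Ab}$ is an additive functor. Each short exact sequence $0\to B'\to B\to B''\to0$ in $\mathcal A'$ has a long exact sequence $$\cdots\to\mathrm{Tor}_n^{\mathrm{Ho}(\mathfrak M)}(A,B')\to\mathrm{Tor}_n^{\mathrm{Ho}(\mathfrak M)}(A,B)\to\mathrm{Tor}_n^{\mathrm{Ho}(\mathfrak M)}(A,B'')\to\mathrm{Tor}_{n-1}^{\mathrm{Ho}(\mathfrak M)}(A,B')\to\cdots$$ ($n\in\mathbb Z$), natural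 in the short exact sequence. The functor $\mathrm{Tor}_n^{\mathrm{Ho}(\mathfrak M)}(A,-)$ factors through $\gamma':\mathcal A'\to\mathrm{Ho}(\mathfrak M')$. 2. For each $B$, $\mathrm{Tor}_n^{\mathrm{Ho}(\mathfrak M)}(-,B):\mathcal A\to\mathbf{Ab}$ is an additive functor, short exact sequences in $\mathcal A$ have long exact sequences in the same sense, and the functor factors through $\gamma:\mathcal A\to\mathrm{Ho}(\mathfrak M)$. 3. There are isomorphisms, natural in $A$ and $B$, $\mathrm{Tor}_n^{\mathrm{Ho}(\mathfrak M)}(A,B)\cong\mathrm{Tor}_n^{\mathfrak M}(QA,QB)$; that is, $\mathrm{Tor}_n^{\mathrm{Ho}(\mathfrak M)}(A,B)\cong H_n(W_{QA}\otimes QB)$ and $\mathrm{Tor}_n^{\mathrm{Ho}(\mathfrak M)}(A,B)\cong H_n(QA\otimes W_{QB})$ for all cofibrant replacements $QA$, $QB$ and all $\mathfrak M$-resolutions $W_{QA}$ of $QA$ and $\mathfrak M'$-resolutions $W_{QB}$ of $QB$. 4. If $\mathcal A$ and $\mathcal A'$ have enough projectives, let $\mathrm{Tor}_n(-,-)$,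 $n\ge0$, be the classical bifunctors: the left derived functors of $-\otimes B$, or of $A\otimes-$. Then, for either of the two, $\mathrm{Tor}_n^{\mathrm{Ho}(\mathfrak M)}(A,B)\cong\mathrm{Tor}_n(QA,QB)$ for all $n\ge1$, naturally in $A$ and $B$. -/

import Mathlib

open CategoryTheory CategoryTheory.Limits

universe t w w' v v' u u'

noncomputable section

namespace HoTor

/-! ## Cotorsion pairs and hereditary abelian model structures -/

section ModelStructure

variable {𝒜 : Type u} [Category.{v} 𝒜] [Abelian 𝒜] [HasExt.{w} 𝒜]

/-- The class of all `Y` with `Ext¹(X, Y) = 0` for every `X` in `P`. -/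
def rightPerp (P : ObjectProperty 𝒜) : ObjectProperty 𝒜 :=
  fun Y => ∀ X, P X → Subsingleton (Abelian.Ext X Y 1)

/-- The class of all `X` with `Ext¹(X, Y) = 0` for every `Y` in `P`. -/
def leftPerp (P : ObjectProperty 𝒜) : ObjectProperty 𝒜 :=
  fun X => ∀ Y, P Y → Subsingleton (Abelian.Ext X Y 1)

/-- `(𝒳, 𝒴)` is a complete cotorsion pair. -/
structure IsCompleteCotorsionPair (𝒳 𝒴 : ObjectProperty 𝒜) : Prop where
  right_eq : 𝒴 = rightPerp 𝒳
  left_eq : 𝒳 = leftPerp 𝒴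
  enoughProjectives : ∀ A : 𝒜, ∃ (Y X : 𝒜) (i : Y ⟶ X) (p : X ⟶ A) (zero : i ≫ p = 0),
    (ShortComplex.mk i p zero).ShortExact ∧ 𝒳 X ∧ 𝒴 Y
  enoughInjectives : ∀ A : 𝒜, ∃ (Y X : 𝒜) (j : A ⟶ Y) (q : Y ⟶ X) (zero : j ≫ q = 0),
    (ShortComplex.mk j q zero).ShortExact ∧ 𝒴 Y ∧ 𝒳 X

/-- A cotorsion pair is hereditary if all higher Ext groups vanish on it. -/
def IsHereditaryPair (𝒳 𝒴 : ObjectProperty 𝒜) : Prop :=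
  ∀ X Y, 𝒳 X → 𝒴 Y → ∀ i : ℕ, 1 ≤ i → Subsingleton (Abelian.Ext X Y i)

/-- A class of objects is thick if, whenever two of the three terms of a short exact sequence
belong to it, so does the third. -/
structure IsThick (P : ObjectProperty 𝒜) : Prop where
  left : ∀ S : ShortComplex 𝒜, S.ShortExact → P S.X₂ → P S.X₃ → P S.X₁
  middle : ∀ S : ShortComplex 𝒜, S.ShortExact → P S.X₁ → P S.X₃ → P S.X₂
  right : ∀ S : ShortComplex 𝒜, S.ShortExact → P S.X₁ → P S.X₂ → P S.X₃

variable (𝒜) in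
/-- An abelian model structure, given by its Hovey triple: the classes `Q` of cofibrant,
`W` of trivial and `R` of fibrant objects. -/
structure AbelianModelStructure where
  Q : ObjectProperty 𝒜
  W : ObjectProperty 𝒜
  R : ObjectProperty 𝒜
  thick : IsThick W
  leftPair : IsCompleteCotorsionPair Q (W ⊓ R)
  rightPair : IsCompleteCotorsionPair (Q ⊓ W) R

namespace AbelianModelStructure

variable (M : AbelianModelStructure 𝒜)

/-- Trivially cofibrant objects. -/
def trivCof : ObjectProperty 𝒜 := M.Q ⊓ M.W

/-- Trivially fibrant objects. -/
def trivFib : ObjectProperty 𝒜 := M.W ⊓ M.R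

/-- The core of the model structure: objects that are cofibrant, trivial and fibrant. -/
def core : ObjectProperty 𝒜 := fun A => M.Q A ∧ M.W A ∧ M.R A

/-- Both cotorsion pairs of the model structure are hereditary. -/
structure IsHereditary : Prop where
  left : IsHereditaryPair M.Q M.trivFib
  right : IsHereditaryPair M.trivCof M.R

/-! ## Replacements -/

/-- A cofibrant replacement sequence `0 ⟶ K ⟶ QA ⟶ A ⟶ 0` of `A`. -/
structure CofibrantReplacement (A : 𝒜) where
  Q : 𝒜
  K : 𝒜
  i : K ⟶ Q
  p : Q ⟶ A
  zero : i ≫ p = 0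
  shortExact : (ShortComplex.mk i p zero).ShortExact
  cofibrant : M.Q Q
  trivFib : M.trivFib K

/-- A fibrant replacement sequence `0 ⟶ A ⟶ RA ⟶ C ⟶ 0` of `A`. -/
structure FibrantReplacement (A : 𝒜) where
  R : 𝒜
  C : 𝒜
  j : A ⟶ R
  q : R ⟶ C
  zero : j ≫ q = 0
  shortExact : (ShortComplex.mk j q zero).ShortExact
  fibrant : M.R R
  trivCof : M.trivCof C

/-- A bifibrant replacement `RQA` of `A`: a fibrant replacement of a cofibrant replacement. -/
structure BifibrantReplacement (A : 𝒜) where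
  cof : M.CofibrantReplacement A
  fib : M.FibrantReplacement cof.Q

variable {M}

/-- The bifibrant object `RQA`. -/
abbrev BifibrantReplacement.RQ {A : 𝒜} (a : M.BifibrantReplacement A) : 𝒜 := a.fib.R

/-- `h : QA ⟶ QB` is a lift `Q(f)` of `f : A ⟶ B`. -/
def CofibrantReplacement.IsLift {A B : 𝒜} (a : M.CofibrantReplacement A)
    (b : M.CofibrantReplacement B) (f : A ⟶ B) (h : a.Q ⟶ b.Q) : Prop :=
  h ≫ b.p = a.p ≫ f

/-- `k : RA ⟶ RB` is an extension `R(h)` of `h : A ⟶ B`. -/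
def FibrantReplacement.IsExtension {A B : 𝒜} (a : M.FibrantReplacement A)
    (b : M.FibrantReplacement B) (h : A ⟶ B) (k : a.R ⟶ b.R) : Prop :=
  a.j ≫ k = h ≫ b.j

/-- `k : RQA ⟶ RQB` is of the form `R(Q(f))`. -/
def BifibrantReplacement.IsLift {A B : 𝒜} (a : M.BifibrantReplacement A)
    (b : M.BifibrantReplacement B) (f : A ⟶ B) (k : a.RQ ⟶ b.RQ) : Prop :=
  ∃ h : a.cof.Q ⟶ b.cof.Q, a.cof.IsLift b.cof f h ∧ a.fib.IsExtension b.fib h k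

variable (M)

lemma nonempty_cofibrantReplacement (A : 𝒜) : Nonempty (M.CofibrantReplacement A) := by
  obtain ⟨Y, X, i, p, z, h, hX, hY⟩ := M.leftPair.enoughProjectives A
  exact ⟨⟨X, Y, i, p, z, h, hX, hY⟩⟩

lemma nonempty_fibrantReplacement (A : 𝒜) : Nonempty (M.FibrantReplacement A) := by
  obtain ⟨Y, X, i, p, z, h, hY, hX⟩ := M.rightPair.enoughInjectives A
  exact ⟨⟨Y, X, i, p, z, h, hY, hX⟩⟩

lemma nonempty_bifibrantReplacement (A : 𝒜) : Nonempty (M.BifibrantReplacement A) := by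
  obtain ⟨a⟩ := M.nonempty_cofibrantReplacement A
  obtain ⟨b⟩ := M.nonempty_fibrantReplacement a.Q
  exact ⟨⟨a, b⟩⟩

/-! ## The homotopy relation, the stable category and the homotopy category -/

/-- Two morphisms are homotopic if their difference factors through an object of the core. -/
def Homotopic : HomRel 𝒜 :=
  fun A B f g => ∃ (O : 𝒜) (_ : M.core O) (a : A ⟶ O) (b : O ⟶ B), a ≫ b = g - f

/-- The stable category of the model structure: same objects, homotopy classes of morphisms. -/
abbrev Stable : Type u := Quotient M.Homotopic

/-- The canonical functor to the stable category. -/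
abbrev toStable : 𝒜 ⥤ M.Stable := Quotient.functor M.Homotopic

/-- The homotopy category (with respect to a choice `ρ` of bifibrant replacements): the objects
are those of `𝒜`, and the morphisms `A ⟶ B` are the homotopy classes of maps `RQA ⟶ RQB`. -/
abbrev Ho (ρ : ∀ A : 𝒜, M.BifibrantReplacement A) : Type u :=
  InducedCategory M.Stable (fun A : 𝒜 => M.toStable.obj (ρ A).RQ)


lemma exists_lift_of_ext {S : ShortComplex 𝒜} (hS : S.ShortExact) {X : 𝒜}
    (h : Subsingleton (Abelian.Ext X S.X₁ 1)) (f : X ⟶ S.X₃) : ∃ k : X ⟶ S.X₂, k ≫ S.g = f := by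
  obtain ⟨x, hx⟩ := Abelian.Ext.covariant_sequence_exact₃ X hS (Abelian.Ext.mk₀ f) (zero_add 1)
    (Subsingleton.elim _ _)
  obtain ⟨k, rfl⟩ := Abelian.Ext.addEquiv₀.symm.surjective x
  refine ⟨k, Abelian.Ext.addEquiv₀.symm.injective ?_⟩
  simpa using hx

lemma exists_extension_of_ext {S : ShortComplex 𝒜} (hS : S.ShortExact) {Y : 𝒜}
    (h : Subsingleton (Abelian.Ext S.X₃ Y 1)) (f : S.X₁ ⟶ Y) :
    ∃ k : S.X₂ ⟶ Y, S.f ≫ k = f := by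
  obtain ⟨x, hx⟩ := Abelian.Ext.contravariant_sequence_exact₁ hS Y (Abelian.Ext.mk₀ f) (add_zero 1)
    (Subsingleton.elim _ _)
  obtain ⟨k, rfl⟩ := Abelian.Ext.addEquiv₀.symm.surjective x
  refine ⟨k, Abelian.Ext.addEquiv₀.symm.injective ?_⟩
  simpa using hx

lemma ext_cof_trivFib {X Y : 𝒜} (hX : M.Q X) (hY : M.trivFib Y) :
    Subsingleton (Abelian.Ext X Y 1) := by
  have h : (M.W ⊓ M.R) Y := hY
  rw [M.leftPair.right_eq] at h
  exact h X hX

lemma ext_trivCof_fib {X Y : 𝒜} (hX : M.trivCof X) (hY : M.R Y) :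
    Subsingleton (Abelian.Ext X Y 1) := by
  rw [M.rightPair.right_eq] at hY
  exact hY X hX

/-- A map from a cofibrant object to a trivially fibrant object factors through the core. -/
lemma exists_core_of_trivFib {X K : 𝒜} (hX : M.Q X) (hK : M.trivFib K) (f : X ⟶ K) :
    ∃ (O : 𝒜) (_ : M.core O) (a : X ⟶ O) (b : O ⟶ K), a ≫ b = f := by
  obtain ⟨Y, O, i, p, z, h, hO, hY⟩ := M.leftPair.enoughProjectives K
  obtain ⟨k, hk⟩ := exists_lift_of_ext h (M.ext_cof_trivFib hX hY) f
  refine ⟨O, ⟨hO, M.thick.middle _ h hY.1 hK.1, ?_⟩, k, p, hk⟩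
  rw [M.rightPair.right_eq]
  intro C hC
  refine subsingleton_of_forall_eq 0 fun x => ?_
  obtain ⟨y, rfl⟩ := Abelian.Ext.covariant_sequence_exact₂ C h x
    (haveI := M.ext_trivCof_fib hC hK.2; Subsingleton.elim _ _)
  have := M.ext_trivCof_fib hC hY.2
  rw [Subsingleton.elim y 0, Abelian.Ext.zero_comp]

/-- A map from a trivially cofibrant object to a fibrant object factors through the core. -/
lemma exists_core_of_trivCof {C Y : 𝒜} (hC : M.trivCof C) (hY : M.R Y) (f : C ⟶ Y) :
    ∃ (O : 𝒜) (_ : M.core O) (a : C ⟶ O) (b : O ⟶ Y), a ≫ b = f := by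
  obtain ⟨O, X, j, q, z, h, hO, hX⟩ := M.rightPair.enoughInjectives C
  obtain ⟨k, hk⟩ := exists_extension_of_ext h (M.ext_trivCof_fib hX hY) f
  refine ⟨O, ⟨?_, M.thick.middle _ h hC.2 hX.2, hO⟩, j, k, hk⟩
  rw [M.leftPair.left_eq]
  intro Z hZ
  refine subsingleton_of_forall_eq 0 fun x => ?_
  obtain ⟨y, rfl⟩ := Abelian.Ext.contravariant_sequence_exact₂ h Z x
    (haveI := M.ext_cof_trivFib hC.1 hZ; Subsingleton.elim _ _)
  have := M.ext_cof_trivFib hX.1 hZ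
  rw [Subsingleton.elim y 0, Abelian.Ext.comp_zero]

variable {M}

lemma CofibrantReplacement.exists_isLift {A B : 𝒜} (a : M.CofibrantReplacement A)
    (b : M.CofibrantReplacement B) (f : A ⟶ B) : ∃ h, a.IsLift b f h :=
  exists_lift_of_ext b.shortExact (M.ext_cof_trivFib a.cofibrant b.trivFib) (a.p ≫ f)

lemma FibrantReplacement.exists_isExtension {A B : 𝒜} (a : M.FibrantReplacement A)
    (b : M.FibrantReplacement B) (h : A ⟶ B) : ∃ k, a.IsExtension b h k :=
  exists_extension_of_ext a.shortExact (M.ext_trivCof_fib a.trivCof b.fibrant) (h ≫ b.j)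

lemma BifibrantReplacement.exists_isLift {A B : 𝒜} (a : M.BifibrantReplacement A)
    (b : M.BifibrantReplacement B) (f : A ⟶ B) : ∃ k, a.IsLift b f k := by
  obtain ⟨h, hh⟩ := a.cof.exists_isLift b.cof f
  obtain ⟨k, hk⟩ := a.fib.exists_isExtension b.fib h
  exact ⟨k, h, hh, hk⟩

/-- Any two choices of `R(Q(f))` have the same homotopy class. -/
lemma BifibrantReplacement.IsLift.toStable_map_eq {A B : 𝒜} {a : M.BifibrantReplacement A}
    {b : M.BifibrantReplacement B} {f : A ⟶ B} {k₁ k₂ : a.RQ ⟶ b.RQ}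
    (h₁ : a.IsLift b f k₁) (h₂ : a.IsLift b f k₂) : M.toStable.map k₁ = M.toStable.map k₂ := by
  obtain ⟨l₁, hl₁, e₁⟩ := h₁
  obtain ⟨l₂, hl₂, e₂⟩ := h₂
  have hz : (l₂ - l₁) ≫ b.cof.p = 0 := by
    rw [Preadditive.sub_comp, hl₁, hl₂, sub_self]
  have : Mono b.cof.i := b.cof.shortExact.mono_f
  obtain ⟨d, hd⟩ : ∃ d : a.cof.Q ⟶ b.cof.K, d ≫ b.cof.i = l₂ - l₁ :=
    ⟨b.cof.shortExact.exact.lift _ hz, b.cof.shortExact.exact.lift_f _ hz⟩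
  obtain ⟨O, hO, x, y, hxy⟩ := M.exists_core_of_trivFib a.cof.cofibrant b.cof.trivFib d
  obtain ⟨x', hx'⟩ : ∃ x' : a.fib.R ⟶ O, a.fib.j ≫ x' = x := exists_extension_of_ext a.fib.shortExact
    (M.ext_trivCof_fib a.fib.trivCof hO.2.2) x
  let m : a.RQ ⟶ b.RQ := k₁ + x' ≫ (y ≫ b.cof.i ≫ b.fib.j)
  have hm : M.toStable.map k₁ = M.toStable.map m :=
    CategoryTheory.Quotient.sound _ ⟨O, hO, x', y ≫ b.cof.i ≫ b.fib.j, by simp [m]⟩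
  have hz' : a.fib.j ≫ (k₂ - m) = 0 := by
    have e₁' : a.fib.j ≫ k₁ = l₁ ≫ b.fib.j := e₁
    have e₂' : a.fib.j ≫ k₂ = l₂ ≫ b.fib.j := e₂
    have : a.fib.j ≫ x' ≫ y ≫ b.cof.i ≫ b.fib.j = (l₂ - l₁) ≫ b.fib.j := by
      rw [reassoc_of% hx', reassoc_of% hxy, reassoc_of% hd]
    simp only [m, Preadditive.comp_sub, Preadditive.comp_add, e₁', e₂', this,
      Preadditive.sub_comp]
    abel
  have : Epi a.fib.q := a.fib.shortExact.epi_g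
  obtain ⟨c, hc⟩ : ∃ c : a.fib.C ⟶ b.RQ, a.fib.q ≫ c = k₂ - m :=
    ⟨a.fib.shortExact.exact.desc _ hz', a.fib.shortExact.exact.g_desc _ hz'⟩
  obtain ⟨O', hO', s, r, hsr⟩ := M.exists_core_of_trivCof a.fib.trivCof b.fib.fibrant c
  refine hm.trans (CategoryTheory.Quotient.sound _ ⟨O', hO', a.fib.q ≫ s, r, ?_⟩)
  rw [Category.assoc, hsr, hc]

lemma BifibrantReplacement.isLift_id {A : 𝒜} (a : M.BifibrantReplacement A) :
    a.IsLift a (𝟙 A) (𝟙 a.RQ) :=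
  ⟨𝟙 _, by simp [CofibrantReplacement.IsLift],
    (Category.comp_id a.fib.j).trans (Category.id_comp a.fib.j).symm⟩

lemma BifibrantReplacement.IsLift.comp {A B C : 𝒜} {a : M.BifibrantReplacement A}
    {b : M.BifibrantReplacement B} {c : M.BifibrantReplacement C} {f : A ⟶ B} {g : B ⟶ C}
    {k : a.RQ ⟶ b.RQ} {l : b.RQ ⟶ c.RQ} (hk : a.IsLift b f k) (hl : b.IsLift c g l) :
    a.IsLift c (f ≫ g) (k ≫ l) := by
  obtain ⟨x, hx, hx'⟩ := hk
  obtain ⟨y, hy, hy'⟩ := hl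
  have hx : x ≫ b.cof.p = a.cof.p ≫ f := hx
  have hy : y ≫ c.cof.p = b.cof.p ≫ g := hy
  have hx' : a.fib.j ≫ k = x ≫ b.fib.j := hx'
  have hy' : b.fib.j ≫ l = y ≫ c.fib.j := hy'
  refine ⟨x ≫ y, ?_, ?_⟩
  · change (x ≫ y) ≫ c.cof.p = a.cof.p ≫ f ≫ g
    rw [Category.assoc, hy, reassoc_of% hx]
  · change a.fib.j ≫ k ≫ l = (x ≫ y) ≫ c.fib.j
    rw [reassoc_of% hx', hy', Category.assoc]

variable (M)

/-- The canonical functor `γ` from `𝒜` to the homotopy category: it is the identity on objects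
and sends `f` to the homotopy class of any `R(Q(f))`. -/
def γ (ρ : ∀ A : 𝒜, M.BifibrantReplacement A) : 𝒜 ⥤ M.Ho ρ where
  obj A := A
  map {A B} f := InducedCategory.homMk (M.toStable.map ((ρ A).exists_isLift (ρ B) f).choose)
  map_id A := by
    apply InducedCategory.hom_ext
    exact (((ρ A).exists_isLift (ρ A) (𝟙 A)).choose_spec.toStable_map_eq (ρ A).isLift_id).trans
      (M.toStable.map_id _)
  map_comp {A B C} f g := by
    apply InducedCategory.hom_ext
    exact (((ρ A).exists_isLift (ρ C) (f ≫ g)).choose_spec.toStable_map_eq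
      (((ρ A).exists_isLift (ρ B) f).choose_spec.comp
        ((ρ B).exists_isLift (ρ C) g).choose_spec)).trans (M.toStable.map_comp _ _)

/-! ## `𝔐`-resolutions -/

/-- An `𝔐`-resolution of `A`: an exact complex obtained by splicing, through `d₀ = ε ≫ η`, a
resolution `⋯ ⟶ W₁ ⟶ W₀ ⟶ A` by trivially cofibrant objects with fibrant kernels and a
coresolution `A ⟶ W₋₁ ⟶ W₋₂ ⟶ ⋯` by trivially fibrant objects with cofibrant cokernels.
(As `η` is mono and `ε` is epi, `ker ε = ker d₀` and `coker η = coker d₀`.) -/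
structure Resolution (A : 𝒜) where
  complex : ChainComplex 𝒜 ℤ
  ε : complex.X 0 ⟶ A
  η : A ⟶ complex.X (-1)
  epi_ε : Epi ε
  mono_η : Mono η
  fac : ε ≫ η = complex.d 0 (-1)
  acyclic : complex.Acyclic
  trivCof : ∀ n : ℤ, 0 ≤ n → M.trivCof (complex.X n)
  fibrant_kernel : ∀ n : ℤ, 0 ≤ n → M.R (kernel (complex.d n (n - 1)))
  trivFib : ∀ n : ℤ, n ≤ -1 → M.trivFib (complex.X n)
  cofibrant_cokernel : ∀ n : ℤ, n ≤ 0 → M.Q (cokernel (complex.d n (n - 1)))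

variable {M}

/-- The chain map `φ` extends `f`. -/
structure Resolution.Extends {A B : 𝒜} (a : M.Resolution A) (b : M.Resolution B) (f : A ⟶ B)
    (φ : a.complex ⟶ b.complex) : Prop where
  ε_comm : φ.f 0 ≫ b.ε = a.ε ≫ f
  η_comm : a.η ≫ φ.f (-1) = f ≫ b.η

/-! ## Categories of choices

Being natural for all possible choices of replacements, resolutions and lifts of morphisms to
them means being natural on the following categories. -/

variable (M)

/-- The category of objects with a chosen cofibrant replacement; a morphism is a morphism `f`
together with a choice of `Q(f)`. -/
structure Cof where
  obj : 𝒜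
  rep : M.CofibrantReplacement obj

/-- The category of objects with a chosen bifibrant replacement; a morphism is a morphism `f`
together with a choice of `R(Q(f))`. -/
structure Bif where
  obj : 𝒜
  rep : M.BifibrantReplacement obj

variable {M}

@[ext]
structure Cof.Hom (X Y : M.Cof) where
  base : X.obj ⟶ Y.obj
  map : X.rep.Q ⟶ Y.rep.Q
  isLift : X.rep.IsLift Y.rep base map

@[ext]
structure Bif.Hom (X Y : M.Bif) where
  base : X.obj ⟶ Y.obj
  map : X.rep.RQ ⟶ Y.rep.RQ
  isLift : X.rep.IsLift Y.rep base map

instance : Category M.Cof where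
  Hom := Cof.Hom
  id X := ⟨𝟙 _, 𝟙 _, by simp [CofibrantReplacement.IsLift]⟩
  comp {X Y Z} f g := ⟨f.base ≫ g.base, f.map ≫ g.map, by
    have hf : f.map ≫ Y.rep.p = X.rep.p ≫ f.base := f.isLift
    have hg : g.map ≫ Z.rep.p = Y.rep.p ≫ g.base := g.isLift
    change (f.map ≫ g.map) ≫ Z.rep.p = X.rep.p ≫ f.base ≫ g.base
    rw [Category.assoc, hg, reassoc_of% hf]⟩
  id_comp f := Cof.Hom.ext (Category.id_comp f.base) (Category.id_comp f.map)
  comp_id f := Cof.Hom.ext (Category.comp_id f.base) (Category.comp_id f.map)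
  assoc f g h := Cof.Hom.ext (Category.assoc f.base g.base h.base)
    (Category.assoc f.map g.map h.map)

instance : Category M.Bif where
  Hom := Bif.Hom
  id X := ⟨𝟙 _, 𝟙 _, X.rep.isLift_id⟩
  comp f g := ⟨f.base ≫ g.base, f.map ≫ g.map, f.isLift.comp g.isLift⟩
  id_comp f := Bif.Hom.ext (Category.id_comp f.base) (Category.id_comp f.map)
  comp_id f := Bif.Hom.ext (Category.comp_id f.base) (Category.comp_id f.map)
  assoc f g h := Bif.Hom.ext (Category.assoc f.base g.base h.base)
    (Category.assoc f.map g.map h.map)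

variable (M)

/-- The functor `(A, QA) ↦ A`. -/
def Cof.base : M.Cof ⥤ 𝒜 where
  obj X := X.obj
  map f := Cof.Hom.base f

/-- The functor `(A, QA) ↦ QA`. -/
def Cof.replacement : M.Cof ⥤ 𝒜 where
  obj X := X.rep.Q
  map f := Cof.Hom.map f

/-- The functor `(A, RQA) ↦ A`. -/
def Bif.base : M.Bif ⥤ 𝒜 where
  obj X := X.obj
  map f := Bif.Hom.base f

/-- The functor `(A, RQA) ↦ RQA`. -/
def Bif.replacement : M.Bif ⥤ 𝒜 where
  obj X := X.rep.RQ
  map f := Bif.Hom.map f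

section Resolved

variable {𝒳 : Type u'} [Category.{v'} 𝒳] (F : 𝒳 ⥤ 𝒜)

/-- The category of objects `x` of `𝒳` with a chosen `𝔐`-resolution of `F x`; a morphism is a
morphism `f` of `𝒳` together with a chain map that extends `F f`. -/
structure Resolved where
  obj : 𝒳
  res : M.Resolution (F.obj obj)

variable {M F}

@[ext]
structure Resolved.Hom (X Y : M.Resolved F) where
  base : X.obj ⟶ Y.obj
  map : X.res.complex ⟶ Y.res.complex
  isExtension : X.res.Extends Y.res (F.map base) map

instance : Category (M.Resolved F) where
  Hom := Resolved.Hom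
  id X := ⟨𝟙 _, 𝟙 _, ⟨by simp, by simp⟩⟩
  comp {X Y Z} f g := ⟨f.base ≫ g.base, f.map ≫ g.map, ⟨by
      have hf := f.isExtension.ε_comm
      have hg := g.isExtension.ε_comm
      rw [HomologicalComplex.comp_f, Category.assoc, hg, reassoc_of% hf, F.map_comp], by
      have hf := f.isExtension.η_comm
      have hg := g.isExtension.η_comm
      rw [HomologicalComplex.comp_f, reassoc_of% hf, hg, F.map_comp, Category.assoc]⟩⟩
  id_comp f := Resolved.Hom.ext (Category.id_comp f.base) (Category.id_comp f.map)
  comp_id f := Resolved.Hom.ext (Category.comp_id f.base) (Category.comp_id f.map)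
  assoc f g h := Resolved.Hom.ext (Category.assoc f.base g.base h.base)
    (Category.assoc f.map g.map h.map)

variable (M F)

/-- The functor `(x, W) ↦ x`. -/
def Resolved.base : M.Resolved F ⥤ 𝒳 where
  obj X := X.obj
  map f := Resolved.Hom.base f

/-- The functor `(x, W) ↦ W`. -/
def Resolved.complex : M.Resolved F ⥤ ChainComplex 𝒜 ℤ where
  obj X := X.res.complex
  map f := Resolved.Hom.map f

end Resolved

end AbelianModelStructure

end ModelStructure

/-! ## Tensor products and the functors Tor -/

section Tensor

variable {𝒜 : Type u} [Category.{v} 𝒜] [Abelian 𝒜]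
variable {𝒜' : Type u'} [Category.{v'} 𝒜'] [Abelian 𝒜']

/-- A tensor product `𝒜 × 𝒜' ⟶ Ab`: a bifunctor that is additive and right exact in each
variable. -/
class IsTensorProduct (T : 𝒜 ⥤ 𝒜' ⥤ AddCommGrpCat.{t}) : Prop where
  additive_right (A : 𝒜) : (T.obj A).Additive
  additive_left (B : 𝒜') : (T.flip.obj B).Additive
  rightExact_right (A : 𝒜) (S : ShortComplex 𝒜') : S.ShortExact →
    (S.map (T.obj A)).Exact ∧ Epi (S.map (T.obj A)).g
  rightExact_left (B : 𝒜') (S : ShortComplex 𝒜) : S.ShortExact →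
    (S.map (T.flip.obj B)).Exact ∧ Epi (S.map (T.flip.obj B)).g

attribute [instance] IsTensorProduct.additive_right IsTensorProduct.additive_left

variable (T : 𝒜 ⥤ 𝒜' ⥤ AddCommGrpCat.{t}) [IsTensorProduct T]

/-- `A` is flat: `A ⊗ -` is exact. -/
def IsFlat (A : 𝒜) : Prop :=
  ∀ S : ShortComplex 𝒜', S.ShortExact → (S.map (T.obj A)).ShortExact

/-- `B` is flat: `- ⊗ B` is exact. -/
def IsFlat' (B : 𝒜') : Prop :=
  ∀ S : ShortComplex 𝒜, S.ShortExact → (S.map (T.flip.obj B)).ShortExact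

/-- The bifunctor `(W, B) ↦ Hₙ(W ⊗ B)`. For an `𝔐`-resolution `W` of `A`, this group is
`ℓTorₙ(A, B)`. -/
def lTor (n : ℤ) : ChainComplex 𝒜 ℤ ⥤ 𝒜' ⥤ AddCommGrpCat.{t} :=
  Functor.flip
    { obj := fun B => (T.flip.obj B).mapHomologicalComplex (ComplexShape.down ℤ) ⋙
        HomologicalComplex.homologyFunctor AddCommGrpCat.{t} (ComplexShape.down ℤ) n
      map := fun g => Functor.whiskerRight
        (NatTrans.mapHomologicalComplex (T.flip.map g) (ComplexShape.down ℤ))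
        (HomologicalComplex.homologyFunctor AddCommGrpCat.{t} (ComplexShape.down ℤ) n) }

/-- The bifunctor `(A, W) ↦ Hₙ(A ⊗ W)`. For an `𝔐'`-resolution `W` of `B`, this group is
`rTorₙ(A, B)`. -/
def rTor (n : ℤ) : 𝒜 ⥤ ChainComplex 𝒜' ℤ ⥤ AddCommGrpCat.{t} where
  obj A := (T.obj A).mapHomologicalComplex (ComplexShape.down ℤ) ⋙
    HomologicalComplex.homologyFunctor AddCommGrpCat.{t} (ComplexShape.down ℤ) n
  map f := Functor.whiskerRight
    (NatTrans.mapHomologicalComplex (T.map f) (ComplexShape.down ℤ))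
    (HomologicalComplex.homologyFunctor AddCommGrpCat.{t} (ComplexShape.down ℤ) n)

/-- Classical Tor, as the left derived functors of `- ⊗ B`. -/
def derivedTor [HasProjectiveResolutions 𝒜] (n : ℕ) : 𝒜 ⥤ 𝒜' ⥤ AddCommGrpCat.{t} :=
  Functor.flip
    { obj := fun B => (T.flip.obj B).leftDerived n
      map := fun g => NatTrans.leftDerived (T.flip.map g) n }

/-- Classical Tor, as the left derived functors of `A ⊗ -`. -/
def derivedTor' [HasProjectiveResolutions 𝒜'] (n : ℕ) : 𝒜 ⥤ 𝒜' ⥤ AddCommGrpCat.{t} where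
  obj A := (T.obj A).leftDerived n
  map f := NatTrans.leftDerived (T.map f) n

end Tensor

/-- Precomposition of a bifunctor in both variables: `(x, y) ↦ T (F x) (G y)`. -/
abbrev precomp₂ {𝒞 𝒟 𝒳 𝒴 ℰ : Type*} [Category* 𝒞] [Category* 𝒟] [Category* 𝒳] [Category* 𝒴]
    [Category* ℰ] (T : 𝒞 ⥤ 𝒟 ⥤ ℰ) (F : 𝒳 ⥤ 𝒞) (G : 𝒴 ⥤ 𝒟) : 𝒳 ⥤ 𝒴 ⥤ ℰ :=
  F ⋙ T ⋙ (Functor.whiskeringLeft 𝒴 𝒟 ℰ).obj G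

/-- Long exact homology sequences, natural in the short exact sequence, for a family of functors
indexed by `ℤ`:
`⋯ ⟶ Fₙ X₁ ⟶ Fₙ X₂ ⟶ Fₙ X₃ ⟶ Fₙ₋₁ X₁ ⟶ Fₙ₋₁ X₂ ⟶ ⋯`. -/
structure LongExactSequences {𝒞 : Type u} [Category.{v} 𝒞] [Abelian 𝒞]
    (F : ℤ → 𝒞 ⥤ AddCommGrpCat.{t}) where
  δ {S : ShortComplex 𝒞} (hS : S.ShortExact) (n : ℤ) : (F n).obj S.X₃ ⟶ (F (n - 1)).obj S.X₁
  naturality {S S' : ShortComplex 𝒞} (hS : S.ShortExact) (hS' : S'.ShortExact) (φ : S ⟶ S')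
    (n : ℤ) : δ hS n ≫ (F (n - 1)).map φ.τ₁ = (F n).map φ.τ₃ ≫ δ hS' n
  exact₂ {S : ShortComplex 𝒞} (hS : S.ShortExact) (n : ℤ) :
    Function.Exact ((F n).map S.f) ((F n).map S.g)
  exact₃ {S : ShortComplex 𝒞} (hS : S.ShortExact) (n : ℤ) :
    Function.Exact ((F n).map S.g) (δ hS n)
  exact₁ {S : ShortComplex 𝒞} (hS : S.ShortExact) (n : ℤ) :
    Function.Exact (δ hS n) ((F (n - 1)).map S.f)

section HoTor

variable {𝒜 : Type u} [Category.{v} 𝒜] [Abelian 𝒜] [HasExt.{w} 𝒜]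
variable {𝒜' : Type u'} [Category.{v'} 𝒜'] [Abelian 𝒜'] [HasExt.{w'} 𝒜']
variable (M : AbelianModelStructure 𝒜) (M' : AbelianModelStructure 𝒜')
variable (T : 𝒜 ⥤ 𝒜' ⥤ AddCommGrpCat.{t}) [IsTensorProduct T]

open AbelianModelStructure

/-- The bifunctor `F` is `(A, B) ↦ Torₙ(QA, QB)`, where `Tor` of two cofibrant objects is computed
by an `𝔐`-resolution of the first one, or an `𝔐'`-resolution of the second one. The isomorphisms
hold for all choices of replacements and resolutions, and are natural for all choices of lifts. -/
structure IsTorCof (n : ℤ) (F : 𝒜 ⥤ 𝒜' ⥤ AddCommGrpCat.{t}) : Prop where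
  left : Nonempty
    (precomp₂ F (Resolved.base M (Cof.replacement M) ⋙ Cof.base M) (Cof.base M') ≅
      precomp₂ (lTor T n) (Resolved.complex M (Cof.replacement M)) (Cof.replacement M'))
  right : Nonempty
    (precomp₂ F (Cof.base M) (Resolved.base M' (Cof.replacement M') ⋙ Cof.base M') ≅
      precomp₂ (rTor T n) (Cof.replacement M) (Resolved.complex M' (Cof.replacement M')))

/-- The bifunctor `F` is `Torₙ` of the homotopy category: `(A, B) ↦ Torₙ(RQA, RQB)`, where `Tor` of
two cofibrant objects is computed by an `𝔐`-resolution of the first one, or an `𝔐'`-resolution of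
the second one. The isomorphisms hold for all choices of replacements and resolutions, and are
natural for all choices of lifts; so `F` is determined up to isomorphism. -/
structure IsTorHo (n : ℤ) (F : 𝒜 ⥤ 𝒜' ⥤ AddCommGrpCat.{t}) : Prop where
  left : Nonempty
    (precomp₂ F (Resolved.base M (Bif.replacement M) ⋙ Bif.base M) (Bif.base M') ≅
      precomp₂ (lTor T n) (Resolved.complex M (Bif.replacement M)) (Bif.replacement M'))
  right : Nonempty
    (precomp₂ F (Bif.base M) (Resolved.base M' (Bif.replacement M') ⋙ Bif.base M') ≅
      precomp₂ (rTor T n) (Bif.replacement M) (Resolved.complex M' (Bif.replacement M')))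

end HoTor

end HoTor

end

noncomputable section

namespace HoTor

/-! The theorem rests on the homology of acyclic complexes of flat objects. If `A` is cofibrant, all
terms of an `𝔐`-resolution `W` of `A` are trivially cofibrant: those in negative degrees are
extensions of cofibrant syzygies (`Resolution.trivCof_X`). So they are flat, `W ⊗ -` turns short
exact sequences into short exact sequences of complexes, and `Hₙ(W ⊗ -)` has long exact sequences.
It vanishes on trivially cofibrant `B`, because `- ⊗ B` is then exact.

Balance: let the syzygy `Zₙ` be the opcycles of `W` in degree `n`, so that `Z₀ = A`. As `- ⊗ B` is
right exact, `Hₙ(W ⊗ B)` is the kernel of `Zₙ ⊗ B ⟶ Wₙ₋₁ ⊗ B` (`homologyLIso`), a `Tor₁` of `Zₙ₋₁`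
and `B`. For two short exact sequences with flat middle terms the snake lemma exchanges the
variables in such kernels (`torLIsoTorR`, `torLIsoTorR'`), and dimension shifting gives all degrees
(`nonempty_lTor_iso_rTor`). These arguments take place in functor categories, so that the
isomorphisms are natural by construction.

Independence of choices: objects with chosen replacements or resolutions form categories whose
projections to the underlying objects are full and essentially surjective. Isomorphisms of functors
descend along such projections, and so do functors that do not see the chosen lifts. For resolutions
balance supplies the latter condition: `Hₙ(A ⊗ W_B)` does not involve `W_A`
(`exists_descent_of_balanced`). For replacements, two lifts `Q(f)` differ by a map through the core,
where `Tor` vanishes.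

The map `QA ⟶ RQA` has a trivially cofibrant cokernel, so it induces an isomorphism on `Tor`, and
`RQ` and `Q` give the same bifunctor (`exists_isTorHo`). The horseshoe lemma, which uses heredity,
carries long exact sequences from cofibrant objects to all objects. Vanishing on trivial objects
then gives the factorization through the homotopy category. In positive degrees balance uses only
left resolutions by flat objects, so a projective resolution in one variable can be compared with an
`𝔐'`-resolution in the other. -/

/-! ## Descent along full and essentially surjective functors -/

section Descent

variable {𝒳 𝒳' 𝒞 𝒞' ℰ : Type*} [Category* 𝒳] [Category* 𝒳'] [Category* 𝒞] [Category* 𝒞']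
  [Category* ℰ]

/-- A functor that identifies all morphisms that `P` identifies descends along `P`. -/
lemma exists_descent (P : 𝒳 ⥤ 𝒞) [P.Full] [P.EssSurj] (G : 𝒳 ⥤ ℰ)
    (hG : ∀ {X Y : 𝒳} (f g : X ⟶ Y), P.map f = P.map g → G.map f = G.map g) :
    ∃ F : 𝒞 ⥤ ℰ, Nonempty (P ⋙ F ≅ G) := by
  let F : 𝒞 ⥤ ℰ :=
    { obj A := G.obj (P.objPreimage A)
      map {A B} f := G.map (P.preimage ((P.objObjPreimageIso A).hom ≫ f ≫
        (P.objObjPreimageIso B).inv))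
      -- Preimages under `P` are not functorial, but the two candidates have the same image under
      -- `P`, which is all that `hG` asks for.
      map_id A := by
        rw [← G.map_id]
        exact hG _ _ (by simp)
      map_comp f g := by
        rw [← G.map_comp]
        exact hG _ _ (by simp) }
  refine ⟨F, ⟨NatIso.ofComponents (fun X =>
    { hom := G.map (P.preimage (P.objObjPreimageIso (P.obj X)).hom)
      inv := G.map (P.preimage (P.objObjPreimageIso (P.obj X)).inv)
      hom_inv_id := ?_
      inv_hom_id := ?_ }) ?_⟩⟩
  · rw [← G.map_comp]
    exact (hG _ (𝟙 _) (by simp)).trans (G.map_id _)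
  · rw [← G.map_comp]
    exact (hG _ (𝟙 _) (by simp)).trans (G.map_id _)
  · intro X Y f
    dsimp [F]
    rw [← G.map_comp, ← G.map_comp]
    exact hG _ _ (by simp)

/-- Isomorphisms of functors descend along full and essentially surjective functors. -/
lemma nonempty_iso_of_comp (P : 𝒳 ⥤ 𝒞) [P.Full] [P.EssSurj] {F G : 𝒞 ⥤ ℰ}
    (e : P ⋙ F ≅ P ⋙ G) : Nonempty (F ≅ G) := by
  refine ⟨NatIso.ofComponents (fun A => (F.mapIso (P.objObjPreimageIso A)).symm ≪≫
    e.app (P.objPreimage A) ≪≫ G.mapIso (P.objObjPreimageIso A)) ?_⟩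
  intro A B f
  have h := e.hom.naturality (P.preimage ((P.objObjPreimageIso A).hom ≫ f ≫
        (P.objObjPreimageIso B).inv))
  simp only [Functor.comp_map, Functor.map_preimage, Functor.map_comp, Category.assoc] at h
  have h' := congrArg (fun k => F.map (P.objObjPreimageIso A).inv ≫ k ≫
    G.map (P.objObjPreimageIso B).hom) h
  simp only [Category.assoc, ← Functor.map_comp, ← Functor.map_comp_assoc, Iso.inv_hom_id,
    Iso.inv_hom_id_assoc, Category.comp_id] at h'
  simpa using h'

/-- Restriction of an isomorphism of bifunctors. -/
def precomp₂Iso {𝒴 𝒴' : Type*} [Category* 𝒴] [Category* 𝒴'] {F G : 𝒞 ⥤ 𝒞' ⥤ ℰ} (e : F ≅ G)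
    (P : 𝒴 ⥤ 𝒞) (P' : 𝒴' ⥤ 𝒞') : precomp₂ F P P' ≅ precomp₂ G P P' :=
  Functor.isoWhiskerLeft P (Functor.isoWhiskerRight e _)

/-- Exchange of the variables in an isomorphism of bifunctors. -/
def flipIso {F G : 𝒞 ⥤ 𝒞' ⥤ ℰ} (e : F ≅ G) : F.flip ≅ G.flip :=
  (flipFunctor _ _ _).mapIso e

lemma nonempty_iso_of_comp_flip (P : 𝒳' ⥤ 𝒞') [P.Full] [P.EssSurj] {F G : 𝒞 ⥤ 𝒞' ⥤ ℰ}
    (e : precomp₂ F (𝟭 _) P ≅ precomp₂ G (𝟭 _) P) : Nonempty (F ≅ G) := by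
  let e' : P ⋙ F.flip ≅ P ⋙ G.flip := flipIso e
  obtain ⟨i⟩ := nonempty_iso_of_comp P e'
  exact ⟨flipIso i⟩

/-- Turns an isomorphism that is natural in all chosen data into one that is natural in the objects
alone, one variable at a time. -/
lemma nonempty_iso_of_precomp₂ (P : 𝒳 ⥤ 𝒞) [P.Full] [P.EssSurj] (P' : 𝒳' ⥤ 𝒞') [P'.Full]
    [P'.EssSurj] {F G : 𝒞 ⥤ 𝒞' ⥤ ℰ} (e : precomp₂ F P P' ≅ precomp₂ G P P') :
    Nonempty (F ≅ G) := by
  obtain ⟨i⟩ := nonempty_iso_of_comp P (F := precomp₂ F (𝟭 _) P') (G := precomp₂ G (𝟭 _) P') e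
  exact nonempty_iso_of_comp_flip P' i

/-- A bifunctor that identifies all morphisms that `P` and `P'` identify descends. -/
lemma exists_descent₂ (P : 𝒳 ⥤ 𝒞) [P.Full] [P.EssSurj] (P' : 𝒳' ⥤ 𝒞') [P'.Full]
    [P'.EssSurj] (G : 𝒳 ⥤ 𝒳' ⥤ ℰ)
    (h : ∀ {X Y : 𝒳} (f g : X ⟶ Y) (Z : 𝒳'), P.map f = P.map g →
      (G.map f).app Z = (G.map g).app Z)
    (h' : ∀ {X Y : 𝒳'} (f g : X ⟶ Y) (Z : 𝒳), P'.map f = P'.map g →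
      (G.obj Z).map f = (G.obj Z).map g) :
    ∃ F : 𝒞 ⥤ 𝒞' ⥤ ℰ, Nonempty (precomp₂ F P P' ≅ G) := by
  obtain ⟨F₁, ⟨e₁⟩⟩ := exists_descent P G (fun f g hfg => by ext Z; exact h f g Z hfg)
  obtain ⟨F₂, ⟨e₂⟩⟩ := exists_descent P' F₁.flip (fun {X Y} f g hfg => by
    ext A
    -- Over objects `P.obj A` the bifunctor `F₁` is `G`, where `h'` applies; essential surjectivity
    -- of `P` then reaches every object of `𝒞`.
    have key : ∀ A, (F₁.obj (P.obj A)).map f = (F₁.obj (P.obj A)).map g := fun A => by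
      rw [← cancel_mono ((e₁.app A).app Y).hom]
      have := (e₁.app A).hom.naturality f
      have h2 := (e₁.app A).hom.naturality g
      exact this.trans ((congrArg _ (h' f g A hfg)).trans h2.symm)
    change (F₁.obj A).map f = (F₁.obj A).map g
    rw [← cancel_epi ((F₁.mapIso (P.objObjPreimageIso A)).app X).hom]
    have h1 := (F₁.map (P.objObjPreimageIso A).hom).naturality f
    have h2 := (F₁.map (P.objObjPreimageIso A).hom).naturality g
    exact h1.symm.trans ((congrArg (· ≫ _) (key _)).trans h2))
  exact ⟨F₂.flip, ⟨(Functor.isoWhiskerLeft P (flipIso e₂) : _) ≪≫ e₁⟩⟩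

/-- If a bifunctor on `𝒳 × 𝒞'` and a bifunctor on `𝒞 × 𝒳'` agree on `𝒳 × 𝒳'`, then
they both come from a bifunctor on `𝒞 × 𝒞'`. -/
lemma exists_descent_of_balanced (P : 𝒳 ⥤ 𝒞) [P.Full] [P.EssSurj] (P' : 𝒳' ⥤ 𝒞') [P'.Full]
    [P'.EssSurj] (G : 𝒳 ⥤ 𝒞' ⥤ ℰ) (G' : 𝒞 ⥤ 𝒳' ⥤ ℰ)
    (e : precomp₂ G (𝟭 _) P' ≅ precomp₂ G' P (𝟭 _)) :
    ∃ F : 𝒞 ⥤ 𝒞' ⥤ ℰ, Nonempty (precomp₂ F P (𝟭 _) ≅ G) ∧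
      Nonempty (precomp₂ F (𝟭 _) P' ≅ G') := by
  obtain ⟨F, ⟨i⟩⟩ := exists_descent P G (fun {X Y} f g hfg => by
    ext B
    -- On the image of `P'` the bifunctor `G` agrees with `G'`, in which `f` and `g` enter only
    -- through `P`. Balance thus replaces an argument with homotopies between lifts.
    have key : ∀ B, (G.map f).app (P'.obj B) = (G.map g).app (P'.obj B) := fun B => by
      rw [← cancel_mono ((e.app Y).app B).hom]
      have h1 := congrArg (fun k => NatTrans.app k B) (e.hom.naturality f)
      have h2 := congrArg (fun k => NatTrans.app k B) (e.hom.naturality g)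
      have h3 : (G'.map (P.map f)).app B = (G'.map (P.map g)).app B := by rw [hfg]
      exact h1.trans ((congrArg _ h3).trans h2.symm)
    rw [← cancel_epi ((G.obj X).map (P'.objObjPreimageIso B).hom)]
    have h1 := (G.map f).naturality (P'.objObjPreimageIso B).hom
    have h2 := (G.map g).naturality (P'.objObjPreimageIso B).hom
    exact h1.trans ((congrArg (· ≫ _) (key _)).trans h2.symm))
  refine ⟨F, ⟨i⟩, nonempty_iso_of_comp P (?_ : P ⋙ precomp₂ F (𝟭 _) P' ≅ P ⋙ G')⟩
  exact precomp₂Iso i (𝟭 _) P' ≪≫ e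

end Descent


/-! ## Exactness in functor categories -/

section FunctorCategory

variable {𝒳 𝒳' 𝒞 : Type*} [Category* 𝒳] [Category* 𝒳'] [Category* 𝒞]

lemma mono_of_app_app {F G : 𝒳 ⥤ 𝒳' ⥤ 𝒞} (f : F ⟶ G)
    (h : ∀ X Y, Mono ((f.app X).app Y)) : Mono f := by
  have : ∀ X, Mono (f.app X) := fun X => @NatTrans.mono_of_mono_app _ _ _ _ _ _ _ (h X)
  exact NatTrans.mono_of_mono_app _

lemma epi_of_app_app {F G : 𝒳 ⥤ 𝒳' ⥤ 𝒞} (f : F ⟶ G) (h : ∀ X Y, Epi ((f.app X).app Y)) :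
    Epi f := by
  have : ∀ X, Epi (f.app X) := fun X => @NatTrans.epi_of_epi_app _ _ _ _ _ _ _ (h X)
  exact NatTrans.epi_of_epi_app _

variable [Abelian 𝒞]

/-- Evaluation is exact, so homology in a functor category is computed pointwise. -/
lemma exact_of_evaluation (S : ShortComplex (𝒳 ⥤ 𝒞))
    (h : ∀ X, (S.map ((evaluation 𝒳 𝒞).obj X)).Exact) : S.Exact := by
  rw [ShortComplex.exact_iff_isZero_homology]
  refine Functor.isZero _ fun X => ?_
  exact ((ShortComplex.exact_iff_isZero_homology _).1 (h X)).of_iso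
    (S.mapHomologyIso ((evaluation 𝒳 𝒞).obj X)).symm

lemma exact_of_evaluation₂ (S : ShortComplex (𝒳 ⥤ 𝒳' ⥤ 𝒞))
    (h : ∀ X Y, (S.map ((evaluation 𝒳 _).obj X ⋙ (evaluation 𝒳' 𝒞).obj Y)).Exact) : S.Exact :=
  exact_of_evaluation _ fun X => exact_of_evaluation _ fun Y => h X Y

lemma _root_.CategoryTheory.ShortComplex.ShortExact.map_evaluation
    {S : ShortComplex (𝒳 ⥤ 𝒞)} (hS : S.ShortExact) (X : 𝒳) :
    (S.map ((evaluation 𝒳 𝒞).obj X)).ShortExact :=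
  hS.map_of_exact _

lemma shortExact_of_evaluation (S : ShortComplex (𝒳 ⥤ 𝒞))
    (h : ∀ X, (S.map ((evaluation 𝒳 𝒞).obj X)).ShortExact) : S.ShortExact where
  exact := exact_of_evaluation _ fun X => (h X).exact
  mono_f := by
    have : ∀ X, Mono (S.f.app X) := fun X => (h X).mono_f
    exact NatTrans.mono_of_mono_app _
  epi_g := by
    have : ∀ X, Epi (S.g.app X) := fun X => (h X).epi_g
    exact NatTrans.epi_of_epi_app _

end FunctorCategory

/-! ## Two consequences of the snake lemma -/

section Snake

variable {𝒞 : Type*} [Category* 𝒞] [Abelian 𝒞]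

/-- In a diagram with exact columns `L₁ ⟶ L₂ ⟶ L₃ ⟶ 0`, with a right exact first row and a left
exact second row, such that the middle vertical map is mono, the kernel of the right
vertical map is isomorphic to the kernel of the first map of the last row. -/
def snakeKernelIso {L₁ L₂ L₃ : ShortComplex 𝒞} (a : L₁ ⟶ L₂) (b : L₂ ⟶ L₃) (w : a ≫ b = 0)
    (h₁ : L₁.Exact) [Epi L₁.g] (h₂ : L₂.Exact) [Mono L₂.f] [Mono a.τ₂]
    (e₁ : (ShortComplex.mk a.τ₁ b.τ₁ (by rw [← ShortComplex.comp_τ₁, w]; rfl)).Exact) [Epi b.τ₁]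
    (e₂ : (ShortComplex.mk a.τ₂ b.τ₂ (by rw [← ShortComplex.comp_τ₂, w]; rfl)).Exact) [Epi b.τ₂]
    (e₃ : (ShortComplex.mk a.τ₃ b.τ₃ (by rw [← ShortComplex.comp_τ₃, w]; rfl)).Exact) [Epi b.τ₃] :
    kernel a.τ₃ ≅ kernel L₃.f := by
  let D : ShortComplex.SnakeInput 𝒞 :=
    { L₀ := kernel a, L₁ := L₁, L₂ := L₂, L₃ := L₃, v₀₁ := kernel.ι a, v₁₂ := a, v₂₃ := b
      w₀₂ := kernel.condition a
      w₁₃ := w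
      h₀ := kernelIsKernel a
      -- Cokernels of morphisms of short complexes are computed termwise.
      h₃ := by
        apply ShortComplex.isColimitOfIsColimitπ
        · exact (CokernelCofork.isColimitMapCoconeEquiv _ _).symm e₁.gIsCokernel
        · exact (CokernelCofork.isColimitMapCoconeEquiv _ _).symm e₂.gIsCokernel
        · exact (CokernelCofork.isColimitMapCoconeEquiv _ _).symm e₃.gIsCokernel
      L₁_exact := h₁
      epi_L₁_g := inferInstance
      L₂_exact := h₂
      mono_L₂_f := inferInstance }
  -- The kernel of the middle vertical map vanishes, so the connecting morphism out of the right
  -- kernel is mono. Exactness at the next term identifies its image with the kernel of `L₃.f`.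
  have hz : D.v₀₁.τ₂ = 0 := by
    rw [← cancel_mono a.τ₂, zero_comp]
    exact D.w₀₂_τ₂
  have hz' : D.L₀.g = 0 := by
    have h : D.v₀₁.τ₂ ≫ D.L₁.g = D.L₀.g ≫ D.v₀₁.τ₃ := D.v₀₁.comm₂₃
    have := D.mono_v₀₁_τ₃
    rw [← cancel_mono D.v₀₁.τ₃, ← h, hz, zero_comp, zero_comp]
  have : Mono D.L₂'.f := D.L₁'_exact.mono_g hz'
  exact (limit.isLimit _).conePointUniqueUpToIso D.h₀τ₃ ≪≫
    D.L₂'_exact.fIsKernel.conePointUniqueUpToIso (limit.isLimit _)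

/-- Two maps that agree after composition with monomorphisms have the same kernel. -/
def kernelIsoOfMono {X Y Z V : 𝒞} (f : X ⟶ Y) (g : X ⟶ Z) (m : Y ⟶ V) (n : Z ⟶ V) [Mono m] [Mono n]
    (h : f ≫ m = g ≫ n) : kernel f ≅ kernel g :=
  (kernelCompMono f m).symm ≪≫ kernelIsoOfEq h ≪≫ kernelCompMono g n

end Snake

/-! ## Tensor products of functors -/

section TensorFunctors

variable {𝒜 : Type u} [Category.{v} 𝒜] {𝒜' : Type u'} [Category.{v'} 𝒜']
variable {𝒳 𝒳' : Type*} [Category* 𝒳] [Category* 𝒳']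
variable (T : 𝒜 ⥤ 𝒜' ⥤ AddCommGrpCat.{t})

/-- The map `F ⊗ H ⟶ G ⊗ H` induced by `F ⟶ G`. -/
def mapL {F G : 𝒳 ⥤ 𝒜} (a : F ⟶ G) (H : 𝒳' ⥤ 𝒜') : precomp₂ T F H ⟶ precomp₂ T G H :=
  Functor.whiskerRight a _

/-- The map `H ⊗ F ⟶ H ⊗ G` induced by `F ⟶ G`. -/
def mapR (H : 𝒳 ⥤ 𝒜) {F G : 𝒳' ⥤ 𝒜'} (b : F ⟶ G) : precomp₂ T H F ⟶ precomp₂ T H G :=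
  Functor.whiskerLeft H (Functor.whiskerLeft T ((Functor.whiskeringLeft _ _ _).map b))

lemma mapL_mapR {F G : 𝒳 ⥤ 𝒜} (a : F ⟶ G) {F' G' : 𝒳' ⥤ 𝒜'} (b : F' ⟶ G') :
    mapL T a F' ≫ mapR T G b = mapR T F b ≫ mapL T a G' := by
  ext X Y : 4
  exact ((T.map (a.app X)).naturality (b.app Y)).symm

variable [Abelian 𝒜] [Abelian 𝒜']

/-- `Tor₁(S.X₃, H)` for a short exact sequence `S` with `Tor₁(S.X₂, H) = 0`. -/
def torL (S : ShortComplex (𝒳 ⥤ 𝒜)) (H : 𝒳' ⥤ 𝒜') : 𝒳 ⥤ 𝒳' ⥤ AddCommGrpCat.{t} :=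
  kernel (mapL T S.f H)

/-- `Tor₁(H, S.X₃)` for a short exact sequence `S` with `Tor₁(H, S.X₂) = 0`. -/
def torR (H : 𝒳 ⥤ 𝒜) (S : ShortComplex (𝒳' ⥤ 𝒜')) : 𝒳 ⥤ 𝒳' ⥤ AddCommGrpCat.{t} :=
  kernel (mapR T H S.f)

def torLIso (S : ShortComplex (𝒳 ⥤ 𝒜)) {H H' : 𝒳' ⥤ 𝒜'} (e : H ≅ H') :
    torL T S H ≅ torL T S H' :=
  kernel.mapIso _ _ (Functor.isoWhiskerLeft S.X₁ (Functor.isoWhiskerLeft T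
      ((Functor.whiskeringLeft _ _ _).mapIso e)))
    (Functor.isoWhiskerLeft S.X₂ (Functor.isoWhiskerLeft T
      ((Functor.whiskeringLeft _ _ _).mapIso e))) (mapL_mapR T S.f e.hom)

def torRIso {H H' : 𝒳 ⥤ 𝒜} (e : H ≅ H') (S : ShortComplex (𝒳' ⥤ 𝒜')) :
    torR T H S ≅ torR T H' S :=
  kernel.mapIso _ _ (Functor.isoWhiskerRight e _) (Functor.isoWhiskerRight e _)
    (mapL_mapR T e.hom S.f).symm

variable [IsTensorProduct T]

/-- This lets every result about one variable pass to the other. -/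
instance : IsTensorProduct T.flip where
  additive_right B := IsTensorProduct.additive_left (T := T) B
  additive_left A := IsTensorProduct.additive_right (T := T) A
  rightExact_right B S hS := IsTensorProduct.rightExact_left (T := T) B S hS
  rightExact_left A S hS := IsTensorProduct.rightExact_right (T := T) A S hS

/-- The complex `S ⊗ H`. -/
def complexL (S : ShortComplex (𝒳 ⥤ 𝒜)) (H : 𝒳' ⥤ 𝒜') :
    ShortComplex (𝒳 ⥤ 𝒳' ⥤ AddCommGrpCat.{t}) :=
  ShortComplex.mk (mapL T S.f H) (mapL T S.g H) (by
    ext X Y : 4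
    have h := congrArg (fun k => NatTrans.app k X) S.zero
    exact ((T.flip.obj (H.obj Y)).map_comp _ _).symm.trans
      ((congrArg _ h).trans ((T.flip.obj (H.obj Y)).map_zero _ _)))

/-- The complex `H ⊗ S`. -/
def complexR (H : 𝒳 ⥤ 𝒜) (S : ShortComplex (𝒳' ⥤ 𝒜')) :
    ShortComplex (𝒳 ⥤ 𝒳' ⥤ AddCommGrpCat.{t}) :=
  ShortComplex.mk (mapR T H S.f) (mapR T H S.g) (by
    ext X Y : 4
    have h := congrArg (fun k => NatTrans.app k Y) S.zero
    exact ((T.obj (H.obj X)).map_comp _ _).symm.trans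
      ((congrArg _ h).trans ((T.obj (H.obj X)).map_zero _ _)))

lemma complexL_exact {S : ShortComplex (𝒳 ⥤ 𝒜)} (hS : S.ShortExact) (H : 𝒳' ⥤ 𝒜') :
    (complexL T S H).Exact ∧ Epi (complexL T S H).g :=
  ⟨exact_of_evaluation₂ _ fun X Y => (IsTensorProduct.rightExact_left (H.obj Y) _
      (hS.map_evaluation X)).1,
    epi_of_app_app _ fun X Y => (IsTensorProduct.rightExact_left (H.obj Y) _
      (hS.map_evaluation X)).2⟩

lemma complexR_exact (H : 𝒳 ⥤ 𝒜) {S : ShortComplex (𝒳' ⥤ 𝒜')} (hS : S.ShortExact) :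
    (complexR T H S).Exact ∧ Epi (complexR T H S).g :=
  ⟨exact_of_evaluation₂ _ fun X Y => (IsTensorProduct.rightExact_right (H.obj X) _
      (hS.map_evaluation Y)).1,
    epi_of_app_app _ fun X Y => (IsTensorProduct.rightExact_right (H.obj X) _
      (hS.map_evaluation Y)).2⟩

lemma mono_mapL {S : ShortComplex (𝒳 ⥤ 𝒜)} (hS : S.ShortExact) (H : 𝒳' ⥤ 𝒜')
    (hH : ∀ Y, IsFlat' T (H.obj Y)) : Mono (mapL T S.f H) :=
  mono_of_app_app _ fun X Y => (hH Y _ (hS.map_evaluation X)).mono_f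

lemma mono_mapR (H : 𝒳 ⥤ 𝒜) {S : ShortComplex (𝒳' ⥤ 𝒜')} (hS : S.ShortExact)
    (hH : ∀ X, IsFlat T (H.obj X)) : Mono (mapR T H S.f) :=
  mono_of_app_app _ fun X Y => (hH X _ (hS.map_evaluation Y)).mono_f

/-- `Tor₁` is balanced. -/
def torLIsoTorR {S : ShortComplex (𝒳 ⥤ 𝒜)} (hS : S.ShortExact) {S' : ShortComplex (𝒳' ⥤ 𝒜')}
    (hS' : S'.ShortExact) (h : ∀ X, IsFlat T (S.X₂.obj X)) (h' : ∀ Y, IsFlat' T (S'.X₂.obj Y)) :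
    torL T S S'.X₃ ≅ torR T S.X₃ S' := by
  -- The 3 × 3 diagram of the tensor products of the terms of `S` with those of `S'`. Flatness of
  -- `S.X₂` makes the middle row left exact, and flatness of `S'.X₂` makes the first map of the
  -- middle column mono.
  let a : complexR T S.X₁ S' ⟶ complexR T S.X₂ S' :=
    { τ₁ := mapL T S.f S'.X₁, τ₂ := mapL T S.f S'.X₂, τ₃ := mapL T S.f S'.X₃
      comm₁₂ := mapL_mapR T S.f S'.f, comm₂₃ := mapL_mapR T S.f S'.g }
  let b : complexR T S.X₂ S' ⟶ complexR T S.X₃ S' :=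
    { τ₁ := mapL T S.g S'.X₁, τ₂ := mapL T S.g S'.X₂, τ₃ := mapL T S.g S'.X₃
      comm₁₂ := mapL_mapR T S.g S'.f, comm₂₃ := mapL_mapR T S.g S'.g }
  have hw : a ≫ b = 0 := by
    ext1
    · exact (complexL T S S'.X₁).zero
    · exact (complexL T S S'.X₂).zero
    · exact (complexL T S S'.X₃).zero
  have := (complexR_exact T S.X₁ hS').2
  have : Mono (complexR T S.X₂ S').f := mono_mapR T S.X₂ hS' h
  have : Mono a.τ₂ := mono_mapL T hS S'.X₂ h'
  have : Epi b.τ₁ := (complexL_exact T hS S'.X₁).2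
  have : Epi b.τ₂ := (complexL_exact T hS S'.X₂).2
  have : Epi b.τ₃ := (complexL_exact T hS S'.X₃).2
  exact snakeKernelIso a b hw (complexR_exact T S.X₁ hS').1 (complexR_exact T S.X₂ hS').1
    (complexL_exact T hS S'.X₁).1 (complexL_exact T hS S'.X₂).1 (complexL_exact T hS S'.X₃).1

/-- The two descriptions of `Tor₂(S.X₃, S'.X₃)` as a subgroup of `S.X₁ ⊗ S'.X₁`. -/
def torLIsoTorR' {S : ShortComplex (𝒳 ⥤ 𝒜)} (hS : S.ShortExact) {S' : ShortComplex (𝒳' ⥤ 𝒜')}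
    (hS' : S'.ShortExact) (h : ∀ X, IsFlat T (S.X₂.obj X)) (h' : ∀ Y, IsFlat' T (S'.X₂.obj Y)) :
    torL T S S'.X₁ ≅ torR T S.X₁ S' :=
  -- Both kernels are the kernel of the diagonal `S.X₁ ⊗ S'.X₁ ⟶ S.X₂ ⊗ S'.X₂`, because the second
  -- leg is mono on either way round the square.
  have := mono_mapR T S.X₂ hS' h
  have := mono_mapL T hS S'.X₂ h'
  kernelIsoOfMono _ _ (mapR T S.X₂ S'.f) (mapL T S.f S'.X₂) (mapL_mapR T S.f S'.f)

/-- Balance of `Tor`, by dimension shifting along two sequences of short exact sequences that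
fit together. -/
lemma nonempty_torL_iso_torR (m : ℕ) (S : ℕ → ShortComplex (𝒳 ⥤ 𝒜))
    (S' : ℕ → ShortComplex (𝒳' ⥤ 𝒜')) (hS : ∀ k, (S k).ShortExact) (hS' : ∀ k, (S' k).ShortExact)
    (h : ∀ k X, IsFlat T ((S k).X₂.obj X)) (h' : ∀ k Y, IsFlat' T ((S' k).X₂.obj Y))
    (e : ∀ k, (S k).X₁ ≅ (S (k + 1)).X₃) (e' : ∀ k, (S' k).X₁ ≅ (S' (k + 1)).X₃) :
    Nonempty (torL T (S m) (S' 0).X₃ ≅ torR T (S 0).X₃ (S' m)) := by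
  induction m generalizing S' with
  | zero => exact ⟨torLIsoTorR T (hS 0) (hS' 0) (h 0) (h' 0)⟩
  | succ m ih =>
    -- One step down in `S` is traded for one step up in `S'`: `(S (m + 1)).X₃` is `(S m).X₁`, the
    -- two forms of balance move this to `(S' 0).X₁`, and that is `(S' 1).X₃`. Hence the induction
    -- hypothesis is needed for the shifted `S'`.
    obtain ⟨i⟩ := ih (fun k => S' (k + 1)) (fun k => hS' _) (fun k => h' _) (fun k => e' _)
    exact ⟨torLIsoTorR T (hS (m + 1)) (hS' 0) (h _) (h' 0) ≪≫ torRIso T (e m).symm (S' 0) ≪≫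
      (torLIsoTorR' T (hS m) (hS' 0) (h m) (h' 0)).symm ≪≫ torLIso T (S m) (e' 0) ≪≫ i⟩

end TensorFunctors


/-! ## The short exact sequences of opcycles of a complex -/

section Opcycles

open HomologicalComplex

variable {𝒞 : Type*} [Category* 𝒞] [Abelian 𝒞] {𝒟 : Type*} [Category* 𝒟] [Abelian 𝒟]
  {ι : Type*} {c : ComplexShape ι}

lemma exact_d_pOpcycles (K : HomologicalComplex 𝒞 c) {i j : ι} (h : c.Rel i j) :
    (ShortComplex.mk (K.d i j) (K.pOpcycles j) (K.d_pOpcycles i j)).Exact :=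
  ShortComplex.exact_of_g_is_cokernel _ (K.opcyclesIsCokernel i j (c.prev_eq' h))

lemma exact_fromOpcycles_pOpcycles (K : HomologicalComplex 𝒞 c) {i j : ι} (h : c.Rel i j) :
    (ShortComplex.mk (K.fromOpcycles i j) (K.pOpcycles j) (by
      rw [← cancel_epi (K.pOpcycles i), p_fromOpcycles_assoc, d_pOpcycles, comp_zero])).Exact := by
  let φ : ShortComplex.mk (K.d i j) (K.pOpcycles j) (K.d_pOpcycles i j) ⟶
      ShortComplex.mk (K.fromOpcycles i j) (K.pOpcycles j) (by
        rw [← cancel_epi (K.pOpcycles i), p_fromOpcycles_assoc, d_pOpcycles, comp_zero]) :=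
    { τ₁ := K.pOpcycles i, τ₂ := 𝟙 _, τ₃ := 𝟙 _ }
  exact (ShortComplex.exact_iff_of_epi_of_isIso_of_mono φ).1 (exact_d_pOpcycles K h)

/-- The kernel of this map is the homology at `i`. -/
lemma mono_fromOpcycles (K : HomologicalComplex 𝒞 c) {i j : ι} (h : c.Rel i j)
    (hK : K.ExactAt i) : Mono (K.fromOpcycles i j) := by
  obtain rfl := c.next_eq' h
  have : K.fromOpcycles i (c.next i) = (K.sc i).fromOpcycles := by
    refine (cancel_epi (K.pOpcycles i)).1 ?_
    exact (K.p_fromOpcycles i _).trans ((K.sc i).p_fromOpcycles).symm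
  rw [this]
  exact ShortComplex.Exact.mono_fromOpcycles hK

lemma fromOpcycles_comp_f {K L : HomologicalComplex 𝒞 c} (φ : K ⟶ L) (i j : ι) :
    K.fromOpcycles i j ≫ φ.f j = opcyclesMap φ i ≫ L.fromOpcycles i j := by
  simp [← cancel_epi (K.pOpcycles i)]

section

variable (F : 𝒞 ⥤ 𝒟) [F.Additive] (K : HomologicalComplex 𝒞 c) (i j : ι)

/-- The canonical map from the opcycles of `F K` to the image under `F` of the opcycles of `K`. -/
def mapOpcycles : ((F.mapHomologicalComplex c).obj K).opcycles i ⟶ F.obj (K.opcycles i) :=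
  ((F.mapHomologicalComplex c).obj K).descOpcycles (F.map (K.pOpcycles i)) (c.prev i) rfl (by
    refine (F.map_comp _ _).symm.trans ?_
    exact (congrArg F.map (K.d_pOpcycles _ i)).trans (F.map_zero _ _))

@[simp]
lemma pOpcycles_mapOpcycles :
    ((F.mapHomologicalComplex c).obj K).pOpcycles i ≫ mapOpcycles F K i =
      F.map (K.pOpcycles i) :=
  p_descOpcycles _ _ _ _ _

lemma pOpcycles_mapOpcycles_assoc {Z : 𝒟} (h : F.obj (K.opcycles i) ⟶ Z) :
    ((F.mapHomologicalComplex c).obj K).pOpcycles i ≫ mapOpcycles F K i ≫ h =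
      F.map (K.pOpcycles i) ≫ h :=
  p_descOpcycles_assoc _ _ _ _ _ _

lemma mapOpcycles_fromOpcycles :
    mapOpcycles F K i ≫ F.map (K.fromOpcycles i j) =
      ((F.mapHomologicalComplex c).obj K).fromOpcycles i j := by
  refine (cancel_epi (((F.mapHomologicalComplex c).obj K).pOpcycles i)).1 ?_
  refine Eq.trans ?_ (p_fromOpcycles _ i j).symm
  refine (pOpcycles_mapOpcycles_assoc F K i _).trans ?_
  exact (F.map_comp _ _).symm.trans (congrArg F.map (K.p_fromOpcycles i j))

/-- Opcycles are a cokernel, and `F` preserves cokernels. -/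
instance [PreservesFiniteColimits F] : IsIso (mapOpcycles F K i) := by
  let L := (F.mapHomologicalComplex c).obj K
  have h := CokernelCofork.mapIsColimit _ (K.opcyclesIsCokernel (c.prev i) i rfl) F
  let e := (L.opcyclesIsCokernel (c.prev i) i rfl).coconePointUniqueUpToIso h
  have : mapOpcycles F K i = e.hom := by
    refine (cancel_epi (L.pOpcycles i)).1 ((pOpcycles_mapOpcycles F K i).trans ?_)
    exact ((L.opcyclesIsCokernel (c.prev i) i rfl).comp_coconePointUniqueUpToIso_hom h
      WalkingParallelPair.one).symm
  rw [this]
  exact e.isIso_hom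

-- Homology is the kernel of the map out of the opcycles, and a right exact functor commutes with
-- opcycles. This is why opcycles, rather than cycles, serve as syzygies.
variable {i j} in
lemma homologyι_mapOpcycles_exact [PreservesFiniteColimits F] (h : c.Rel i j) :
    ∃ w : (((F.mapHomologicalComplex c).obj K).homologyι i ≫ mapOpcycles F K i) ≫
      F.map (K.fromOpcycles i j) = 0, (ShortComplex.mk _ _ w).Exact := by
  let L := (F.mapHomologicalComplex c).obj K
  have w : (L.homologyι i ≫ mapOpcycles F K i) ≫ F.map (K.fromOpcycles i j) = 0 := by
    exact (Category.assoc _ _ _).trans ((congrArg _ (mapOpcycles_fromOpcycles F K i j)).trans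
      (L.homologyι_comp_fromOpcycles i j))
  refine ⟨w, ?_⟩
  refine ShortComplex.exact_of_iso (S₁ := ShortComplex.mk _ _ (L.homologyι_comp_fromOpcycles i j))
    (ShortComplex.isoMk (Iso.refl _) (asIso (mapOpcycles F K i)) (Iso.refl _) ?_ ?_)
    (ShortComplex.exact_of_f_is_kernel _ (L.homologyIsKernel i j (c.next_eq' h)))
  · simp [L]
  · exact (mapOpcycles_fromOpcycles F K i j).trans (Category.comp_id _).symm

end

end Opcycles

/-! ### Homology of a tensor product with a complex, as a kernel -/

section

open HomologicalComplex

variable {𝒜 : Type u} [Category.{v} 𝒜] [Abelian 𝒜]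
variable {𝒜' : Type u'} [Category.{v'} 𝒜'] [Abelian 𝒜']
variable {𝒳 𝒳' : Type*} [Category* 𝒳] [Category* 𝒳'] {ι : Type*} {c : ComplexShape ι}

/-- The sequence `opcycles i ⟶ K j ⟶ opcycles j`, for a functor with values in complexes. -/
def opcyclesSeq (K : 𝒳 ⥤ HomologicalComplex 𝒜 c) (i j : ι) : ShortComplex (𝒳 ⥤ 𝒜) where
  X₁ := K ⋙ opcyclesFunctor 𝒜 c i
  X₂ := K ⋙ eval 𝒜 c j
  X₃ := K ⋙ opcyclesFunctor 𝒜 c j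
  f :=
    { app X := (K.obj X).fromOpcycles i j
      naturality _ _ f := (fromOpcycles_comp_f (K.map f) i j).symm }
  g :=
    { app X := (K.obj X).pOpcycles j
      naturality _ _ f := (p_opcyclesMap (K.map f) j).symm }
  zero := by
    ext X
    change (K.obj X).fromOpcycles i j ≫ (K.obj X).pOpcycles j = 0
    rw [← cancel_epi ((K.obj X).pOpcycles i), p_fromOpcycles_assoc, d_pOpcycles, comp_zero]

lemma opcyclesSeq_shortExact (K : 𝒳 ⥤ HomologicalComplex 𝒜 c) {i j : ι} (h : c.Rel i j)
    (hK : ∀ X, (K.obj X).ExactAt i) : (opcyclesSeq K i j).ShortExact :=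
  shortExact_of_evaluation _ fun X =>
    { exact := exact_fromOpcycles_pOpcycles (K.obj X) h
      mono_f := mono_fromOpcycles (K.obj X) h (hK X)
      epi_g := inferInstanceAs (Epi ((K.obj X).pOpcycles j)) }

variable (T : 𝒜 ⥤ 𝒜' ⥤ AddCommGrpCat.{t}) [IsTensorProduct T]

/-- The bifunctor `(W, B) ↦ Hᵢ(W ⊗ B)` for complexes of any shape. -/
def homologyL (c : ComplexShape ι) (i : ι) : HomologicalComplex 𝒜 c ⥤ 𝒜' ⥤ AddCommGrpCat.{t} :=
  Functor.flip
    { obj := fun B => (T.flip.obj B).mapHomologicalComplex c ⋙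
        HomologicalComplex.homologyFunctor AddCommGrpCat.{t} c i
      map := fun g => Functor.whiskerRight (NatTrans.mapHomologicalComplex (T.flip.map g) c)
        (HomologicalComplex.homologyFunctor AddCommGrpCat.{t} c i) }

instance preservesFiniteColimits_left (B : 𝒜') : PreservesFiniteColimits (T.flip.obj B) :=
  ((Functor.preservesFiniteColimits_tfae (T.flip.obj B)).out 0 3).1
    fun S hS => IsTensorProduct.rightExact_left B S hS

/-- `Hᵢ(W ⊗ B)` as a kernel. -/
def homologyLIso (K : 𝒳 ⥤ HomologicalComplex 𝒜 c) (H : 𝒳' ⥤ 𝒜') {i j : ι} (h : c.Rel i j) :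
    precomp₂ (homologyL T c i) K H ≅ torL T (opcyclesSeq K i j) H := by
  -- Pointwise this is the map of `homologyι_mapOpcycles_exact`; what remains is naturality in both
  -- variables.
  let z : precomp₂ (homologyL T c i) K H ⟶ precomp₂ T (opcyclesSeq K i j).X₁ H :=
    { app X :=
        { app Y := (((T.flip.obj (H.obj Y)).mapHomologicalComplex c).obj (K.obj X)).homologyι i ≫
            mapOpcycles (T.flip.obj (H.obj Y)) (K.obj X) i
          naturality Y Y' f := by
            let φ := (NatTrans.mapHomologicalComplex (T.flip.map (H.map f)) c).app (K.obj X)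
            change homologyMap φ i ≫ _ ≫ _ = (_ ≫ _) ≫
              (T.obj ((K.obj X).opcycles i)).map (H.map f)
            rw [homologyι_naturality_assoc, Category.assoc]
            congr 1
            rw [← cancel_epi (HomologicalComplex.pOpcycles _ i), p_opcyclesMap_assoc,
              pOpcycles_mapOpcycles, pOpcycles_mapOpcycles_assoc]
            exact ((T.flip.map (H.map f)).naturality ((K.obj X).pOpcycles i)).symm }
      naturality X X' f := by
        ext Y : 2
        let F := T.flip.obj (H.obj Y)
        let φ := (F.mapHomologicalComplex c).map (K.map f)
        change homologyMap φ i ≫ _ ≫ _ = (_ ≫ _) ≫ F.map (opcyclesMap (K.map f) i)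
        rw [homologyι_naturality_assoc, Category.assoc]
        congr 1
        rw [← cancel_epi (HomologicalComplex.pOpcycles _ i), p_opcyclesMap_assoc,
          pOpcycles_mapOpcycles, pOpcycles_mapOpcycles_assoc]
        exact (F.map_comp _ _).symm.trans ((congrArg F.map (p_opcyclesMap (K.map f) i).symm).trans
          (F.map_comp _ _)) }
  have w : z ≫ mapL T (opcyclesSeq K i j).f H = 0 := by
    ext X Y : 4
    exact (homologyι_mapOpcycles_exact (T.flip.obj (H.obj Y)) (K.obj X) h).1
  have hz : Mono z := mono_of_app_app _ fun X Y =>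
    have : Mono ((((T.flip.obj (H.obj Y)).mapHomologicalComplex c).obj (K.obj X)).homologyι i) :=
      inferInstanceAs (Mono (ShortComplex.homologyι _))
    mono_comp' this (IsIso.mono_of_iso (mapOpcycles (T.flip.obj (H.obj Y)) (K.obj X) i))
  have hex : (ShortComplex.mk z _ w).Exact := exact_of_evaluation₂ _ fun X Y =>
    (homologyι_mapOpcycles_exact (T.flip.obj (H.obj Y)) (K.obj X) h).2
  exact hex.fIsKernel.conePointUniqueUpToIso (limit.isLimit _)

/-- Exchange of the two factors. -/
def torLFlipIso (S : ShortComplex (𝒳' ⥤ 𝒜')) (H : 𝒳 ⥤ 𝒜) :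
    (torL T.flip S H).flip ≅ torR T H S := by
  -- Kernels of bifunctors are pointwise, so the flipped inclusion is again a kernel.
  let z : (torL T.flip S H).flip ⟶ precomp₂ T H S.X₁ :=
    (flipFunctor _ _ _).map (kernel.ι (mapL T.flip S.f H))
  have w : z ≫ mapR T H S.f = 0 := by
    ext X Y : 4
    exact congrArg (fun k : torL T.flip S H ⟶ precomp₂ T.flip S.X₂ H => (k.app Y).app X) (kernel.condition (mapL T.flip S.f H))
  have h := ShortComplex.kernelSequence_exact (mapL T.flip S.f H)
  have hz : Mono z := mono_of_app_app _ fun X Y =>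
    inferInstanceAs (Mono (((kernel.ι (mapL T.flip S.f H)).app Y).app X))
  have hex : (ShortComplex.mk z _ w).Exact := exact_of_evaluation₂ _ fun X Y =>
    (h.map ((evaluation _ _).obj Y)).map ((evaluation _ _).obj X)
  exact hex.fIsKernel.conePointUniqueUpToIso (limit.isLimit _)

/-- The bifunctor `(A, W) ↦ Hᵢ(A ⊗ W)` for complexes of any shape. -/
abbrev homologyR (c : ComplexShape ι) (i : ι) :
    𝒜 ⥤ HomologicalComplex 𝒜' c ⥤ AddCommGrpCat.{t} :=
  (homologyL T.flip c i).flip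

/-- `Hᵢ(A ⊗ W)` as a kernel. -/
def homologyRIso (H : 𝒳 ⥤ 𝒜) (K : 𝒳' ⥤ HomologicalComplex 𝒜' c) {i j : ι} (h : c.Rel i j) :
    precomp₂ (homologyR T c i) H K ≅ torR T H (opcyclesSeq K i j) :=
  flipIso (homologyLIso T.flip K H h) ≪≫ torLFlipIso T _ H

end


/-! ## Balance for complexes of flat objects -/

section Balance

open HomologicalComplex

variable {𝒜 : Type u} [Category.{v} 𝒜] [Abelian 𝒜]
variable {𝒜' : Type u'} [Category.{v'} 𝒜'] [Abelian 𝒜']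
variable {𝒳 𝒳' : Type*} [Category* 𝒳] [Category* 𝒳']
variable (T : 𝒜 ⥤ 𝒜' ⥤ AddCommGrpCat.{t}) [IsTensorProduct T]

/-- `e` and `e'` number the degrees upwards from two base degrees, and only the complexes from there
on matter. So one shift serves complexes indexed by `ℕ` and by `ℤ`, and any starting degree. -/
lemma nonempty_torL_opcyclesSeq_iso {ι ι' : Type*} {c : ComplexShape ι} {c' : ComplexShape ι'}
    (V : 𝒳 ⥤ HomologicalComplex 𝒜 c) (V' : 𝒳' ⥤ HomologicalComplex 𝒜' c')
    (e : ℕ → ι) (e' : ℕ → ι') (he : ∀ k, c.Rel (e (k + 1)) (e k))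
    (he' : ∀ k, c'.Rel (e' (k + 1)) (e' k))
    (hV : ∀ X k, (V.obj X).ExactAt (e (k + 1))) (hV' : ∀ X k, (V'.obj X).ExactAt (e' (k + 1)))
    (h : ∀ X k, IsFlat T ((V.obj X).X (e k))) (h' : ∀ X k, IsFlat' T ((V'.obj X).X (e' k)))
    (m : ℕ) :
    Nonempty (torL T (opcyclesSeq V (e (m + 1)) (e m)) (V' ⋙ opcyclesFunctor 𝒜' c' (e' 0)) ≅
      torR T (V ⋙ opcyclesFunctor 𝒜 c (e 0)) (opcyclesSeq V' (e' (m + 1)) (e' m))) :=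
  nonempty_torL_iso_torR T m (fun k => opcyclesSeq V (e (k + 1)) (e k))
    (fun k => opcyclesSeq V' (e' (k + 1)) (e' k))
    (fun k => opcyclesSeq_shortExact V (he k) fun X => hV X k)
    (fun k => opcyclesSeq_shortExact V' (he' k) fun X => hV' X k)
    (fun k X => h X k) (fun k X => h' X k) (fun _ => Iso.refl _) (fun _ => Iso.refl _)

/-- Balance in positive degrees needs only left resolutions by flat objects. -/
lemma nonempty_homologyL_iso_homologyR {ι ι' : Type*} {c : ComplexShape ι} {c' : ComplexShape ι'}
    (V : 𝒳 ⥤ HomologicalComplex 𝒜 c) (V' : 𝒳' ⥤ HomologicalComplex 𝒜' c')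
    (e : ℕ → ι) (e' : ℕ → ι') (he : ∀ k, c.Rel (e (k + 1)) (e k))
    (he' : ∀ k, c'.Rel (e' (k + 1)) (e' k))
    (hV : ∀ X k, (V.obj X).ExactAt (e (k + 1))) (hV' : ∀ X k, (V'.obj X).ExactAt (e' (k + 1)))
    (h : ∀ X k, IsFlat T ((V.obj X).X (e k))) (h' : ∀ X k, IsFlat' T ((V'.obj X).X (e' k)))
    (m : ℕ) :
    Nonempty (precomp₂ (homologyL T c (e (m + 1))) V (V' ⋙ opcyclesFunctor 𝒜' c' (e' 0)) ≅
      precomp₂ (homologyR T c' (e' (m + 1))) (V ⋙ opcyclesFunctor 𝒜 c (e 0)) V') := by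
  obtain ⟨i⟩ := nonempty_torL_opcyclesSeq_iso T V V' e e' he he' hV hV' h h' m
  exact ⟨homologyLIso T V _ (he m) ≪≫ i ≪≫ (homologyRIso T _ V' (he' m)).symm⟩

/-- Balance in all degrees for acyclic complexes of flat objects. -/
lemma nonempty_lTor_iso_rTor (V : 𝒳 ⥤ ChainComplex 𝒜 ℤ) (V' : 𝒳' ⥤ ChainComplex 𝒜' ℤ)
    (hV : ∀ X, (V.obj X).Acyclic) (hV' : ∀ X, (V'.obj X).Acyclic)
    (h : ∀ X i, IsFlat T ((V.obj X).X i)) (h' : ∀ X i, IsFlat' T ((V'.obj X).X i)) (n : ℤ) :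
    Nonempty (precomp₂ (lTor T n) V (V' ⋙ opcyclesFunctor 𝒜' _ 0) ≅
      precomp₂ (rTor T n) (V ⋙ opcyclesFunctor 𝒜 _ 0) V') := by
  have hc : ∀ i : ℤ, (ComplexShape.down ℤ).Rel i (i - 1) := fun i => by simp
  have hseq : ∀ i j : ℤ, (ComplexShape.down ℤ).Rel i j → (opcyclesSeq V i j).ShortExact :=
    fun i j hij => opcyclesSeq_shortExact V hij fun X => hV X i
  have hseq' : ∀ i j : ℤ, (ComplexShape.down ℤ).Rel i j → (opcyclesSeq V' i j).ShortExact :=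
    fun i j hij => opcyclesSeq_shortExact V' hij fun X => hV' X i
  rcases lt_or_ge 0 n with hn | hn
  · obtain ⟨m, rfl⟩ : ∃ m : ℕ, n = ((m + 1 : ℕ) : ℤ) := ⟨(n - 1).toNat, by omega⟩
    exact nonempty_homologyL_iso_homologyR T V V' (fun k => (k : ℤ)) (fun k => (k : ℤ))
      (fun k => by simp) (fun k => by simp) (fun X k => hV X _) (fun X k => hV' X _)
      (fun X k => h X _) (fun X k => h' X _) m
  -- In degree `-m ≤ 0` the shift begins at the syzygies in degrees `-m` of `V` and `-m - 1` of
  -- `V'`, and climbs until it meets the resolved objects; `i'` is the result with its indices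
  -- simplified.
  · obtain ⟨m, rfl⟩ : ∃ m : ℕ, n = -(m : ℤ) := ⟨(-n).toNat, by omega⟩
    obtain ⟨i⟩ := nonempty_torL_opcyclesSeq_iso T V V' (fun k => -(m : ℤ) + k)
      (fun k => -(m : ℤ) - 1 + k) (fun k => by simp [add_assoc]) (fun k => by simp [add_assoc])
      (fun X k => hV X _) (fun X k => hV' X _) (fun X k => h X _) (fun X k => h' X _) m
    have i' : torL T (opcyclesSeq V 1 0) (opcyclesSeq V' (-(m : ℤ)) (-(m : ℤ) - 1)).X₃ ≅
        torR T (opcyclesSeq V (-(m : ℤ)) (-(m : ℤ) - 1)).X₁ (opcyclesSeq V' 0 (-1)) := by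
      have h₁ : -(m : ℤ) + ((m + 1 : ℕ) : ℤ) = 1 := by push_cast; ring
      have h₂ : -(m : ℤ) + (m : ℤ) = 0 := by ring
      have h₃ : -(m : ℤ) - 1 + ((0 : ℕ) : ℤ) = -(m : ℤ) - 1 := by simp
      have h₄ : -(m : ℤ) + ((0 : ℕ) : ℤ) = -(m : ℤ) := by simp
      have h₅ : -(m : ℤ) - 1 + ((m + 1 : ℕ) : ℤ) = 0 := by push_cast; ring
      have h₆ : -(m : ℤ) - 1 + (m : ℤ) = -1 := by ring
      rw [h₁, h₂, h₃, h₄, h₅, h₆] at i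
      exact i
    -- The resolved object of `V'` is the left end of its sequence in degrees `0, -1`, so the second
    -- form of balance comes first. The shift is then used backwards, and the first form of balance
    -- ends at degree `-m` of `V'`.
    exact ⟨homologyLIso T V _ (hc _) ≪≫
      torLIsoTorR' T (hseq _ _ (hc _)) (hseq' 0 (-1) (by simp)) (fun X => h X _)
        (fun X => h' X _) ≪≫ i'.symm ≪≫
      torLIsoTorR T (hseq 1 0 (by simp)) (hseq' _ _ (hc _)) (fun X => h X _) (fun X => h' X _) ≪≫
      (homologyRIso T _ V' (hc _)).symm⟩

end Balance


/-! ## Closure properties of the classes of a model structure -/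

section Closure

variable {𝒜 : Type u} [Category.{v} 𝒜] [Abelian 𝒜] [HasExt.{w} 𝒜]

instance (P : ObjectProperty 𝒜) : (leftPerp P).IsClosedUnderIsomorphisms where
  of_iso {X X'} e hX Y hY := by
    have := hX Y hY
    refine subsingleton_of_forall_eq 0 fun x => ?_
    have h : (Abelian.Ext.mk₀ e.inv).comp ((Abelian.Ext.mk₀ e.hom).comp x (zero_add 1))
        (zero_add 1) = x := by simp
    rw [← h, Subsingleton.elim ((Abelian.Ext.mk₀ e.hom).comp x (zero_add 1)) 0,
      Abelian.Ext.comp_zero]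

instance (P : ObjectProperty 𝒜) : (rightPerp P).IsClosedUnderIsomorphisms where
  of_iso {Y Y'} e hY X hX := by
    have := hY X hX
    refine subsingleton_of_forall_eq 0 fun x => ?_
    have h : (x.comp (Abelian.Ext.mk₀ e.inv) (add_zero 1)).comp (Abelian.Ext.mk₀ e.hom)
        (add_zero 1) = x := by simp
    rw [← h, Subsingleton.elim (x.comp (Abelian.Ext.mk₀ e.inv) (add_zero 1)) 0,
      Abelian.Ext.zero_comp]

lemma leftPerp_middle (P : ObjectProperty 𝒜) {S : ShortComplex 𝒜} (hS : S.ShortExact)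
    (h₁ : leftPerp P S.X₁) (h₃ : leftPerp P S.X₃) : leftPerp P S.X₂ := fun Y hY => by
  have := h₁ Y hY
  have := h₃ Y hY
  refine subsingleton_of_forall_eq 0 fun x => ?_
  obtain ⟨y, rfl⟩ := Abelian.Ext.contravariant_sequence_exact₂ hS Y x (Subsingleton.elim _ _)
  rw [Subsingleton.elim y 0, Abelian.Ext.comp_zero]

lemma rightPerp_middle (P : ObjectProperty 𝒜) {S : ShortComplex 𝒜} (hS : S.ShortExact)
    (h₁ : rightPerp P S.X₁) (h₃ : rightPerp P S.X₃) : rightPerp P S.X₂ := fun X hX => by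
  have := h₁ X hX
  have := h₃ X hX
  refine subsingleton_of_forall_eq 0 fun x => ?_
  obtain ⟨y, rfl⟩ := Abelian.Ext.covariant_sequence_exact₂ X hS x (Subsingleton.elim _ _)
  rw [Subsingleton.elim y 0, Abelian.Ext.zero_comp]

lemma leftPerp_projective (P : ObjectProperty 𝒜) (Z : 𝒜) [Projective Z] : leftPerp P Z :=
  fun _ _ => subsingleton_of_forall_eq 0 fun x => x.eq_zero_of_projective

namespace AbelianModelStructure

variable (M : AbelianModelStructure 𝒜)

instance : M.Q.IsClosedUnderIsomorphisms := by
  rw [M.leftPair.left_eq]; infer_instance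

instance : M.R.IsClosedUnderIsomorphisms := by
  rw [M.rightPair.right_eq]; infer_instance

lemma Q_middle {S : ShortComplex 𝒜} (hS : S.ShortExact) (h₁ : M.Q S.X₁) (h₃ : M.Q S.X₃) :
    M.Q S.X₂ := by
  rw [M.leftPair.left_eq] at *
  exact leftPerp_middle _ hS h₁ h₃

lemma trivFib_middle {S : ShortComplex 𝒜} (hS : S.ShortExact) (h₁ : M.trivFib S.X₁)
    (h₃ : M.trivFib S.X₃) : M.trivFib S.X₂ := by
  change (M.W ⊓ M.R) _ at *
  rw [M.leftPair.right_eq] at *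
  exact rightPerp_middle _ hS h₁ h₃

variable {M} in
/-- Cofibrant objects are closed under kernels of epimorphisms. -/
lemma IsHereditary.Q_left (hM : M.IsHereditary) {S : ShortComplex 𝒜} (hS : S.ShortExact)
    (h₂ : M.Q S.X₂) (h₃ : M.Q S.X₃) : M.Q S.X₁ := by
  rw [M.leftPair.left_eq]
  intro Y hY
  have := hM.left _ _ h₂ hY 1 le_rfl
  -- Here the vanishing of `Ext²` enters, which a cotorsion pair alone does not provide.
  have := hM.left _ _ h₃ hY 2 (by omega)
  refine subsingleton_of_forall_eq 0 fun x => ?_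
  obtain ⟨y, rfl⟩ := Abelian.Ext.contravariant_sequence_exact₁ hS Y x (n₁ := 2) rfl
    (Subsingleton.elim _ _)
  rw [Subsingleton.elim y 0, Abelian.Ext.comp_zero]

/-- When trivially cofibrant objects are flat, projective objects are therefore flat, and projective
resolutions can take part in balance. -/
lemma trivCof_projective (P : 𝒜) [Projective P] : M.trivCof P := by
  change (M.Q ⊓ M.W) P
  rw [M.rightPair.left_eq]
  exact leftPerp_projective _ P

end AbelianModelStructure

/-- Lift a map between the right ends of short exact sequences to a map of sequences. -/
lemma exists_shortExact_map_of_right {S S' : ShortComplex 𝒜} (hS' : S'.ShortExact)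
    (h : Subsingleton (Abelian.Ext S.X₂ S'.X₁ 1)) (z : S.X₃ ⟶ S'.X₃) :
    ∃ (z' : S.X₁ ⟶ S'.X₁) (y : S.X₂ ⟶ S'.X₂), z' ≫ S'.f = S.f ≫ y ∧ y ≫ S'.g = S.g ≫ z := by
  obtain ⟨y, hy⟩ := AbelianModelStructure.exists_lift_of_ext hS' h (S.g ≫ z)
  have := hS'.mono_f
  have hz : (S.f ≫ y) ≫ S'.g = 0 := by rw [Category.assoc, hy, S.zero_assoc, zero_comp]
  exact ⟨hS'.exact.lift (S.f ≫ y) hz, y, hS'.exact.lift_f _ hz, hy⟩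

/-- Extend a map between the left ends of short exact sequences to a map of sequences. -/
lemma exists_shortExact_map_of_left {S S' : ShortComplex 𝒜} (hS : S.ShortExact)
    (h : Subsingleton (Abelian.Ext S.X₃ S'.X₂ 1)) (z' : S.X₁ ⟶ S'.X₁) :
    ∃ (z : S.X₃ ⟶ S'.X₃) (y : S.X₂ ⟶ S'.X₂), z' ≫ S'.f = S.f ≫ y ∧ y ≫ S'.g = S.g ≫ z := by
  obtain ⟨y, hy⟩ := AbelianModelStructure.exists_extension_of_ext hS h (z' ≫ S'.f)
  have := hS.epi_g
  have hz : S.f ≫ (y ≫ S'.g) = 0 := by rw [reassoc_of% hy, S'.zero, comp_zero]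
  exact ⟨hS.exact.desc (y ≫ S'.g) hz, y, hy.symm, (hS.exact.g_desc _ hz).symm⟩

end Closure

/-- Dependent choice along `ℤ`, in both directions. -/
lemma exists_int_sequence {α : ℤ → Type*} (r : ∀ n, α n → α (n + 1) → Prop) (a : α 0)
    (up : ∀ n, 0 ≤ n → ∀ x, ∃ y, r n x y) (down : ∀ n, n ≤ -1 → ∀ y, ∃ x, r n x y) :
    ∃ s : ∀ n, α n, s 0 = a ∧ ∀ n, r n (s n) (s (n + 1)) := by
  choose f hf using up
  choose g hg using down
  let p : ∀ n : ℕ, α n := fun n =>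
    Nat.rec (motive := fun n : ℕ => α n) a (fun n x => f n (by omega) x) n
  -- The index is off by one: the first step down from `0` lands in `Int.negSucc 0 = -1`.
  let q : ∀ n : ℕ, α (Int.negSucc n) := fun n =>
    Nat.rec (motive := fun n : ℕ => α (Int.negSucc n)) (g (Int.negSucc 0) (by omega) a)
      (fun n x => g (Int.negSucc (n + 1)) (by omega) x) n
  refine ⟨fun n => match n with
    | Int.ofNat n => p n
    | Int.negSucc n => q n, rfl, ?_⟩
  rintro (n | (_ | n))
  · exact hf n (by omega) (p n)
  · exact hg (Int.negSucc 0) (by omega) a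
  · exact hg (Int.negSucc (n + 1)) (by omega) (q n)


/-! ## Existence and functoriality of resolutions -/

section OfSyzygies

open HomologicalComplex

variable {𝒜 : Type u} [Category.{v} 𝒜] [Abelian 𝒜]
variable {Z W : ℤ → 𝒜} (i : ∀ n, Z (n + 1) ⟶ W n) (p : ∀ n, W n ⟶ Z n) (w : ∀ n, i n ≫ p n = 0)

/-- The complex obtained by splicing short exact sequences `Z (n + 1) ⟶ W n ⟶ Z n`. -/
def splice : ChainComplex 𝒜 ℤ :=
  ChainComplex.of W (fun n => p (n + 1) ≫ i n) (fun n => by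
    rw [Category.assoc, reassoc_of% (w (n + 1)), zero_comp, comp_zero])

lemma splice_d (n : ℤ) : (splice i p w).d (n + 1) n = p (n + 1) ≫ i n :=
  ChainComplex.of_d W (fun n => p (n + 1) ≫ i n) n

variable {i p w}

lemma splice_acyclic (h : ∀ n, (ShortComplex.mk (i n) (p n) (w n)).ShortExact) :
    (splice i p w).Acyclic := fun n => by
  obtain ⟨m, rfl⟩ : ∃ m, n = m + 1 := ⟨n - 1, by ring⟩
  rw [exactAt_iff' _ (m + 1 + 1) (m + 1) m (by simp) (by simp)]
  have := (h (m + 1 + 1)).epi_g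
  have := (h m).mono_f
  -- Exactness in the middle is unaffected by an epi on the left term or a mono on the right term;
  -- `T` is compared in this way with the short exact sequence and with the spliced complex.
  let T : ShortComplex 𝒜 := ShortComplex.mk (p (m + 1 + 1) ≫ i (m + 1)) (p (m + 1))
    (by rw [Category.assoc, w, comp_zero])
  let φ : T ⟶ ShortComplex.mk (i (m + 1)) (p (m + 1)) (w _) :=
    { τ₁ := p (m + 1 + 1), τ₂ := 𝟙 _, τ₃ := 𝟙 _ }
  have : Epi φ.τ₁ := (h (m + 1 + 1)).epi_g
  have : IsIso φ.τ₂ := inferInstanceAs (IsIso (𝟙 _))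
  have : Mono φ.τ₃ := inferInstanceAs (Mono (𝟙 _))
  have hT := (ShortComplex.exact_iff_of_epi_of_isIso_of_mono φ).2 (h (m + 1)).exact
  let ψ : T ⟶ (splice i p w).sc' (m + 1 + 1) (m + 1) m :=
    { τ₁ := 𝟙 _, τ₂ := 𝟙 _, τ₃ := i m
      comm₁₂ := (Category.id_comp _).trans ((splice_d i p w _).trans (Category.comp_id _).symm)
      comm₂₃ := (Category.id_comp _).trans (splice_d i p w _) }
  have : Epi ψ.τ₁ := inferInstanceAs (Epi (𝟙 _))
  have : IsIso ψ.τ₂ := inferInstanceAs (IsIso (𝟙 _))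
  have : Mono ψ.τ₃ := (h m).mono_f
  exact (ShortComplex.exact_iff_of_epi_of_isIso_of_mono ψ).1 hT

/-- The kernels of a spliced complex. -/
def kernelSpliceIso (h : ∀ n, (ShortComplex.mk (i n) (p n) (w n)).ShortExact) (n : ℤ) :
    kernel ((splice i p w).d (n + 1) n) ≅ Z (n + 1 + 1) :=
  have := (h n).mono_f
  kernelIsoOfEq (splice_d i p w n) ≪≫ kernelCompMono (p (n + 1)) (i n) ≪≫
    (limit.isLimit _).conePointUniqueUpToIso (h (n + 1)).fIsKernel

/-- The cokernels of a spliced complex. -/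
def cokernelSpliceIso (h : ∀ n, (ShortComplex.mk (i n) (p n) (w n)).ShortExact) (n : ℤ) :
    cokernel ((splice i p w).d (n + 1) n) ≅ Z n :=
  have := (h (n + 1)).epi_g
  cokernelIsoOfEq (splice_d i p w n) ≪≫ cokernelEpiComp (p (n + 1)) (i n) ≪≫
    (colimit.isColimit _).coconePointUniqueUpToIso (h n).gIsCokernel

end OfSyzygies

namespace AbelianModelStructure

open HomologicalComplex

variable {𝒜 : Type u} [Category.{v} 𝒜] [Abelian 𝒜] [HasExt.{w} 𝒜]
variable {M : AbelianModelStructure 𝒜}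

variable (M) in
/-- Every object has an `𝔐`-resolution. -/
lemma nonempty_resolution (A : 𝒜) : Nonempty (M.Resolution A) := by
  -- The sequence consists of the syzygies, starting at `Z 0 = A`. Upwards it uses the pair `(Q ⊓ W,
  -- R)`, downwards the pair `(Q, W ⊓ R)`; the terms `W n` are extracted afterwards.
  obtain ⟨Z, rfl, hZ⟩ := exists_int_sequence (α := fun _ => 𝒜) (fun n X Y =>
    ∃ (W : 𝒜) (i : Y ⟶ W) (p : W ⟶ X) (w : i ≫ p = 0), (ShortComplex.mk i p w).ShortExact ∧
      (0 ≤ n → M.trivCof W ∧ M.R Y) ∧ (n ≤ -1 → M.trivFib W ∧ M.Q X)) A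
    (fun n hn X => by
      obtain ⟨Y, W, i, p, w, h, hW, hY⟩ := M.rightPair.enoughProjectives X
      exact ⟨Y, W, i, p, w, h, fun _ => ⟨hW, hY⟩, fun h => by omega⟩)
    (fun n hn Y => by
      obtain ⟨W, X, i, p, w, h, hW, hX⟩ := M.leftPair.enoughInjectives Y
      exact ⟨X, W, i, p, w, h, fun h => by omega, fun _ => ⟨hW, hX⟩⟩)
  choose W i p w h hcof hfib using hZ
  -- The index `-1 + 1` reduces to `0`, so this is a map out of `Z 0`.
  let η : Z (-1 + 1) ⟶ W (-1) := i (-1)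
  exact ⟨{
    complex := splice i p w
    ε := p 0
    η := η
    epi_ε := (h 0).epi_g
    mono_η := (h (-1)).mono_f
    fac := by
      have hη := splice_d i p w (-1)
      exact hη.symm
    acyclic := splice_acyclic h
    trivCof := fun n hn => (hcof n hn).1
    fibrant_kernel := fun n hn => by
      obtain ⟨m, rfl⟩ : ∃ m, n = m + 1 := ⟨n - 1, by ring⟩
      rw [add_sub_cancel_right]
      exact M.R.prop_of_iso (kernelSpliceIso h m).symm (hcof (m + 1) hn).2
    trivFib := fun n hn => (hfib n hn).1
    cofibrant_cokernel := fun n hn => by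
      obtain ⟨m, rfl⟩ : ∃ m, n = m + 1 := ⟨n - 1, by ring⟩
      rw [add_sub_cancel_right]
      exact M.Q.prop_of_iso (cokernelSpliceIso h m).symm (hfib m (by omega)).2 }⟩

namespace Resolution

variable {A B : 𝒜} (a : M.Resolution A) (b : M.Resolution B)

lemma d_ε : a.complex.d 1 0 ≫ a.ε = 0 := by
  have := a.mono_η
  rw [← cancel_mono a.η, Category.assoc, a.fac, d_comp_d, zero_comp]

/-- As `η` is mono, replacing `d₀` by `ε` does not affect exactness at `W₀`. -/
lemma exact_d_ε : (ShortComplex.mk (a.complex.d 1 0) a.ε a.d_ε).Exact := by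
  have := a.mono_η
  let φ : ShortComplex.mk (a.complex.d 1 0) a.ε a.d_ε ⟶ a.complex.sc' 1 0 (-1) :=
    { τ₁ := 𝟙 _, τ₂ := 𝟙 _, τ₃ := a.η
      comm₁₂ := (Category.id_comp _).trans (Category.comp_id _).symm
      comm₂₃ := (Category.id_comp _).trans a.fac.symm }
  have : Epi φ.τ₁ := inferInstanceAs (Epi (𝟙 _))
  have : IsIso φ.τ₂ := inferInstanceAs (IsIso (𝟙 _))
  have : Mono φ.τ₃ := a.mono_η
  exact (ShortComplex.exact_iff_of_epi_of_isIso_of_mono φ).2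
    ((exactAt_iff' _ 1 0 (-1) (by simp) (by simp)).1 (a.acyclic 0))

/-- The resolved object as an object of opcycles of the resolution. -/
def opcyclesIso : a.complex.opcycles 0 ≅ A :=
  have := a.epi_ε
  (a.complex.opcyclesIsCokernel 1 0 (by simp)).coconePointUniqueUpToIso a.exact_d_ε.gIsCokernel

lemma pOpcycles_opcyclesIso_hom : a.complex.pOpcycles 0 ≫ a.opcyclesIso.hom = a.ε :=
  have := a.epi_ε
  (a.complex.opcyclesIsCokernel 1 0 (by simp)).comp_coconePointUniqueUpToIso_hom
    a.exact_d_ε.gIsCokernel WalkingParallelPair.one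

lemma pOpcycles_opcyclesIso_hom_assoc {Z : 𝒜} (h : A ⟶ Z) :
    a.complex.pOpcycles 0 ≫ a.opcyclesIso.hom ≫ h = a.ε ≫ h := by
  rw [← Category.assoc, pOpcycles_opcyclesIso_hom]

lemma opcyclesIso_hom_η : a.opcyclesIso.hom ≫ a.η = a.complex.fromOpcycles 0 (-1) := by
  rw [← cancel_epi (a.complex.pOpcycles 0), pOpcycles_opcyclesIso_hom_assoc, a.fac,
    p_fromOpcycles]

/-- The short complex `opcycles (n + 1) ⟶ Wₙ ⟶ opcycles n`. -/
abbrev syzygySeq (n : ℤ) : ShortComplex 𝒜 :=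
  ShortComplex.mk (a.complex.fromOpcycles (n + 1) n) (a.complex.pOpcycles n) (by
    rw [← cancel_epi (a.complex.pOpcycles (n + 1)), p_fromOpcycles_assoc, d_pOpcycles, comp_zero])

lemma shortExact (n : ℤ) : (a.syzygySeq n).ShortExact where
  exact := exact_fromOpcycles_pOpcycles _ (by simp)
  mono_f := mono_fromOpcycles _ (by simp) (a.acyclic _)
  epi_g := inferInstanceAs (Epi (a.complex.pOpcycles n))

lemma cofibrant_opcycles {n : ℤ} (hn : n ≤ -1) : M.Q (a.complex.opcycles n) := by
  have h := a.cofibrant_cokernel (n + 1) (by omega)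
  rw [add_sub_cancel_right] at h
  exact M.Q.prop_of_iso ((colimit.isColimit _).coconePointUniqueUpToIso
    (a.complex.opcyclesIsCokernel (n + 1) n (by simp))) h

/-- By acyclicity the kernel of the differential out of degree `n` is the opcycles in degree `n +
1`. -/
lemma fibrant_opcycles {n : ℤ} (hn : 0 ≤ n) : M.R (a.complex.opcycles (n + 1)) := by
  have h := a.fibrant_kernel n hn
  have := (a.shortExact n).mono_f
  have e₁ := (limit.isLimit _).conePointUniqueUpToIso (a.shortExact n).fIsKernel
  have : Mono (a.complex.fromOpcycles n (n - 1)) := mono_fromOpcycles _ (by simp) (a.acyclic _)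
  exact M.R.prop_of_iso ((kernelIsoOfEq (a.complex.p_fromOpcycles n (n - 1))).symm ≪≫
    kernelCompMono _ _ ≪≫ e₁) h

/-- All terms of a resolution of a cofibrant object are trivially cofibrant. -/
lemma trivCof_X (hA : M.Q A) (n : ℤ) : M.trivCof (a.complex.X n) := by
  rcases le_or_gt 0 n with hn | hn
  · exact a.trivCof n hn
  -- In negative degrees `Wₙ` is an extension of cofibrant syzygies. For `n = -1` the left one is
  -- `A`, which is where `hA` is needed.
  · refine ⟨M.Q_middle (a.shortExact n) ?_ (a.cofibrant_opcycles (by omega)),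
      (a.trivFib n (by omega)).1⟩
    obtain rfl | hn' := eq_or_ne n (-1)
    · exact M.Q.prop_of_iso a.opcyclesIso.symm hA
    · exact a.cofibrant_opcycles (by omega)

/-- Morphisms extend to morphisms of resolutions. -/
lemma exists_extends (f : A ⟶ B) : ∃ φ, a.Extends b f φ := by
  -- The maps of syzygies start from `f` in degree `0`. Upwards they are lifted, from trivially
  -- cofibrant terms against fibrant syzygies; downwards they are extended, from cofibrant syzygies
  -- into trivially fibrant terms.
  obtain ⟨z, hz₀, hz⟩ := exists_int_sequence
    (α := fun n => (a.complex.opcycles n ⟶ b.complex.opcycles n))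
    (fun n z z' => ∃ y : a.complex.X n ⟶ b.complex.X n,
      z' ≫ b.complex.fromOpcycles (n + 1) n = a.complex.fromOpcycles (n + 1) n ≫ y ∧
      y ≫ b.complex.pOpcycles n = a.complex.pOpcycles n ≫ z)
    (a.opcyclesIso.hom ≫ f ≫ b.opcyclesIso.inv)
    (fun n hn z => exists_shortExact_map_of_right (S := a.syzygySeq n)
      (b.shortExact n) (M.ext_trivCof_fib (a.trivCof n hn) (b.fibrant_opcycles hn)) z)
    (fun n hn z' => exists_shortExact_map_of_left (a.shortExact n)
      (S' := b.syzygySeq n)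
      (M.ext_cof_trivFib (a.cofibrant_opcycles hn) (b.trivFib n hn)) z')
  choose y hi hp using hz
  refine ⟨{ f := y, comm' := ?_ }, ?_, ?_⟩
  · rintro i j (rfl : j + 1 = i)
    rw [← p_fromOpcycles, ← p_fromOpcycles, reassoc_of% (hp (j + 1)), hi j, Category.assoc]
  · rw [← b.pOpcycles_opcyclesIso_hom, ← a.pOpcycles_opcyclesIso_hom]
    change y 0 ≫ _ = _
    rw [reassoc_of% (hp 0), hz₀]
    simp
  · have h := hi (-1)
    have h' : (a.opcyclesIso.hom ≫ f ≫ b.opcyclesIso.inv) ≫ b.complex.fromOpcycles 0 (-1) =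
      a.complex.fromOpcycles 0 (-1) ≫ y (-1) := by rw [← hz₀]; exact h
    rw [← a.opcyclesIso_hom_η, ← b.opcyclesIso_hom_η] at h'
    simpa using h'.symm

end Resolution

section

variable {𝒳 : Type u'} [Category.{v'} 𝒳] (F : 𝒳 ⥤ 𝒜)

/-- Fullness is the existence of lifts to resolutions, and essential surjectivity is the existence
of resolutions. Together they permit descent from chosen data; the instances for `Cof.base` and
`Bif.base` play the same role. -/
instance : (Resolved.base M F).Full where
  map_surjective {X Y} f := by
    obtain ⟨φ, hφ⟩ := X.res.exists_extends Y.res (F.map f)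
    exact ⟨⟨f, φ, hφ⟩, rfl⟩

instance : (Resolved.base M F).EssSurj where
  mem_essImage X := ⟨⟨X, (M.nonempty_resolution (F.obj X)).some⟩, ⟨Iso.refl _⟩⟩

/-- The resolved object as opcycles of the resolution, naturally. -/
def Resolved.opcyclesIso :
    Resolved.complex M F ⋙ opcyclesFunctor 𝒜 _ 0 ≅ Resolved.base M F ⋙ F :=
  NatIso.ofComponents (fun X => X.res.opcyclesIso) (fun {X Y} f => by
    have h : (Resolved.Hom.map f).f 0 ≫ Y.res.ε = X.res.ε ≫ F.map (Resolved.Hom.base f) :=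
      (Resolved.Hom.isExtension f).ε_comm
    change opcyclesMap (Resolved.Hom.map f) 0 ≫ Y.res.opcyclesIso.hom =
      X.res.opcyclesIso.hom ≫ F.map (Resolved.Hom.base f)
    rw [← cancel_epi (X.res.complex.pOpcycles 0), p_opcyclesMap_assoc,
      Resolution.pOpcycles_opcyclesIso_hom, h, Resolution.pOpcycles_opcyclesIso_hom_assoc])

end

instance : (Cof.base M).Full where
  map_surjective {X Y} f := by
    obtain ⟨h, hh⟩ := X.rep.exists_isLift Y.rep f
    exact ⟨⟨f, h, hh⟩, rfl⟩

instance : (Cof.base M).EssSurj where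
  mem_essImage X := ⟨⟨X, (M.nonempty_cofibrantReplacement X).some⟩, ⟨Iso.refl _⟩⟩

instance : (Bif.base M).Full where
  map_surjective {X Y} f := by
    obtain ⟨h, hh⟩ := X.rep.exists_isLift Y.rep f
    exact ⟨⟨f, h, hh⟩, rfl⟩

instance : (Bif.base M).EssSurj where
  mem_essImage X := ⟨⟨X, (M.nonempty_bifibrantReplacement X).some⟩, ⟨Iso.refl _⟩⟩

end AbelianModelStructure


/-! ## The homology of the tensor product with a fixed complex -/

namespace LongExactSequences

variable {𝒞 : Type u} [Category.{v} 𝒞] [Abelian 𝒞] {F : ℤ → 𝒞 ⥤ AddCommGrpCat.{t}}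
  (L : LongExactSequences F) {S : ShortComplex 𝒞} (hS : S.ShortExact)

include L hS

/-- Every third term of the long exact sequence vanishes: degree `n + 1` gives injectivity, degree
`n` surjectivity. -/
lemma isIso_map_f (h : ∀ n, IsZero ((F n).obj S.X₃)) (n : ℤ) : IsIso ((F n).map S.f) := by
  have h₃ := fun n => AddCommGrpCat.subsingleton_of_isZero (h n)
  rw [ConcreteCategory.isIso_iff_bijective]
  refine ⟨(injective_iff_map_eq_zero ((F n).map S.f).hom).2 fun x hx => ?_, fun x => ?_⟩
  · obtain ⟨m, rfl⟩ : ∃ m, n = m - 1 := ⟨n + 1, by ring⟩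
    obtain ⟨y, rfl⟩ := (L.exact₁ hS m x).1 hx
    have := h₃ m
    rw [Subsingleton.elim y 0, map_zero]
  · have := h₃ n
    exact (L.exact₂ hS n x).1 (Subsingleton.elim _ _)

lemma isIso_map_g (h : ∀ n, IsZero ((F n).obj S.X₁)) (n : ℤ) : IsIso ((F n).map S.g) := by
  have h₁ := fun n => AddCommGrpCat.subsingleton_of_isZero (h n)
  rw [ConcreteCategory.isIso_iff_bijective]
  refine ⟨(injective_iff_map_eq_zero ((F n).map S.g).hom).2 fun x hx => ?_, fun x => ?_⟩
  · obtain ⟨y, rfl⟩ := (L.exact₂ hS n x).1 hx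
    have := h₁ n
    rw [Subsingleton.elim y 0, map_zero]
  · have := h₁ (n - 1)
    exact (L.exact₃ hS n x).1 (Subsingleton.elim _ _)

end LongExactSequences

section

open HomologicalComplex

variable {𝒜 : Type u} [Category.{v} 𝒜] [Abelian 𝒜]
variable {𝒜' : Type u'} [Category.{v'} 𝒜'] [Abelian 𝒜']
variable (T : 𝒜 ⥤ 𝒜' ⥤ AddCommGrpCat.{t}) [IsTensorProduct T]

/-- The complex `W ⊗ B` as a functor in `B`. -/
def tensorComplex (W : ChainComplex 𝒜 ℤ) : 𝒜' ⥤ ChainComplex AddCommGrpCat.{t} ℤ where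
  obj B := ((T.flip.obj B).mapHomologicalComplex _).obj W
  map g := (NatTrans.mapHomologicalComplex (T.flip.map g) _).app W

instance (W : ChainComplex 𝒜 ℤ) : (tensorComplex T W).Additive where
  map_add {X Y f g} := by
    ext i : 1
    exact (T.obj (W.X i)).map_add

instance (W : ChainComplex 𝒜 ℤ) (n : ℤ) : ((lTor T n).obj W).Additive :=
  inferInstanceAs (tensorComplex T W ⋙ homologyFunctor _ _ n).Additive

variable {T}

/-- An exact functor preserves acyclic complexes. -/
lemma isZero_lTor {W : ChainComplex 𝒜 ℤ} (hW : W.Acyclic) {B : 𝒜'} (hB : IsFlat' T B) (n : ℤ) :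
    IsZero (((lTor T n).obj W).obj B) := by
  have : (T.flip.obj B).PreservesHomology := ((T.flip.obj B).exact_tfae.out 0 2).1 hB
  have h : (((T.flip.obj B).mapHomologicalComplex (ComplexShape.down ℤ)).obj W).ExactAt n :=
    ShortComplex.Exact.map (hW n) (T.flip.obj B)
  exact h.isZero_homology

lemma tensorComplex_shortExact {W : ChainComplex 𝒜 ℤ} (hW : ∀ i, IsFlat T (W.X i))
    {S : ShortComplex 𝒜'} (hS : S.ShortExact) : (S.map (tensorComplex T W)).ShortExact :=
  HomologicalComplex.shortExact_of_degreewise_shortExact _ fun i => hW i S hS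

/-- The long exact sequences of `Hₙ(W ⊗ -)` for a complex `W` of flat objects. -/
def lTorLongExactSequences {W : ChainComplex 𝒜 ℤ} (hW : ∀ i, IsFlat T (W.X i)) :
    LongExactSequences fun n => (lTor T n).obj W where
  δ hS n := (tensorComplex_shortExact hW hS).δ n (n - 1) (by simp)
  naturality hS hS' φ n :=
    HomologySequence.δ_naturality ((tensorComplex T W).mapShortComplex.map φ)
      (tensorComplex_shortExact hW hS) (tensorComplex_shortExact hW hS') n (n - 1) (by simp)
  exact₂ hS n := (ShortComplex.ab_exact_iff_function_exact _).1
    ((tensorComplex_shortExact hW hS).homology_exact₂ n)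
  exact₃ hS n := (ShortComplex.ab_exact_iff_function_exact _).1
    ((tensorComplex_shortExact hW hS).homology_exact₃ n (n - 1) (by simp))
  exact₁ hS n := (ShortComplex.ab_exact_iff_function_exact _).1
    ((tensorComplex_shortExact hW hS).homology_exact₁ n (n - 1) (by simp))

end


/-! ## `Tor` of cofibrant objects -/

/-- Bifunctors precomposed with isomorphic functors are isomorphic. -/
def precomp₂ArgIso {𝒞 𝒟 𝒳 𝒴 ℰ : Type*} [Category* 𝒞] [Category* 𝒟] [Category* 𝒳] [Category* 𝒴]
    [Category* ℰ] (T : 𝒞 ⥤ 𝒟 ⥤ ℰ) {F F' : 𝒳 ⥤ 𝒞} (e : F ≅ F') {G G' : 𝒴 ⥤ 𝒟} (e' : G ≅ G') :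
    precomp₂ T F G ≅ precomp₂ T F' G' :=
  Functor.isoWhiskerLeft F (Functor.isoWhiskerLeft T
    ((Functor.whiskeringLeft 𝒴 𝒟 ℰ).mapIso e')) ≪≫ Functor.isoWhiskerRight e _

namespace AbelianModelStructure

variable {𝒜 : Type u} [Category.{v} 𝒜] [Abelian 𝒜] [HasExt.{w} 𝒜] (M : AbelianModelStructure 𝒜)

section

variable {M} {𝒳 : Type u'} [Category.{v'} 𝒳] (F : 𝒳 ⥤ 𝒜) (hF : ∀ X, M.Q (F.obj X))

/-- A resolution of `F x` is a resolution of the cofibrant object `F x`. -/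
def Resolved.toCofibrant : M.Resolved F ⥤ M.Resolved M.Q.ι where
  obj X := ⟨(M.Q.lift F hF).obj X.obj, X.res⟩
  map {X Y} (f : Resolved.Hom X Y) :=
    Resolved.Hom.mk ((M.Q.lift F hF).map f.base) f.map f.isExtension
  map_id X := Resolved.Hom.ext ((M.Q.lift F hF).map_id X.obj) rfl
  map_comp f g := Resolved.Hom.ext
    ((M.Q.lift F hF).map_comp (Resolved.Hom.base f) (Resolved.Hom.base g)) rfl

end

/-- The functor `(A, QA) ↦ QA` to cofibrant objects. -/
def Cof.cofibrant : M.Cof ⥤ M.Q.FullSubcategory :=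
  M.Q.lift (Cof.replacement M) fun X => X.rep.cofibrant

variable {M} in
lemma BifibrantReplacement.cofibrant {A : 𝒜} (a : M.BifibrantReplacement A) : M.Q a.RQ :=
  M.Q_middle a.fib.shortExact a.cof.cofibrant a.fib.trivCof.1

/-- The functor `(A, RQA) ↦ RQA` to cofibrant objects. -/
def Bif.cofibrant : M.Bif ⥤ M.Q.FullSubcategory :=
  M.Q.lift (Bif.replacement M) fun X => X.rep.cofibrant

/-- The category of objects with a chosen bifibrant replacement; a morphism is a morphism `f`
together with a choice of `Q(f)` and of `R(Q(f))`. -/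
structure CofBif where
  biRep : M.Bif

variable {M} in
@[ext]
structure CofBif.Hom (X Y : M.CofBif) where
  base : X.biRep.obj ⟶ Y.biRep.obj
  cofMap : X.biRep.rep.cof.Q ⟶ Y.biRep.rep.cof.Q
  map : X.biRep.rep.RQ ⟶ Y.biRep.rep.RQ
  isLift : X.biRep.rep.cof.IsLift Y.biRep.rep.cof base cofMap
  isExtension : X.biRep.rep.fib.IsExtension Y.biRep.rep.fib cofMap map

instance : Category M.CofBif where
  Hom := CofBif.Hom
  id X := ⟨𝟙 _, 𝟙 _, 𝟙 _, by simp [CofibrantReplacement.IsLift],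
    (Category.comp_id _).trans (Category.id_comp _).symm⟩
  comp {X Y Z} f g := ⟨f.base ≫ g.base, f.cofMap ≫ g.cofMap, f.map ≫ g.map, by
      have hf : f.cofMap ≫ Y.biRep.rep.cof.p = X.biRep.rep.cof.p ≫ f.base := f.isLift
      have hg : g.cofMap ≫ Z.biRep.rep.cof.p = Y.biRep.rep.cof.p ≫ g.base := g.isLift
      change (f.cofMap ≫ g.cofMap) ≫ Z.biRep.rep.cof.p = X.biRep.rep.cof.p ≫ f.base ≫ g.base
      rw [Category.assoc, hg, reassoc_of% hf], by
      have hf : X.biRep.rep.fib.j ≫ f.map = f.cofMap ≫ Y.biRep.rep.fib.j := f.isExtension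
      have hg : Y.biRep.rep.fib.j ≫ g.map = g.cofMap ≫ Z.biRep.rep.fib.j := g.isExtension
      change X.biRep.rep.fib.j ≫ f.map ≫ g.map = (f.cofMap ≫ g.cofMap) ≫ Z.biRep.rep.fib.j
      rw [reassoc_of% hf, hg, Category.assoc]⟩
  id_comp f := CofBif.Hom.ext (Category.id_comp f.base) (Category.id_comp f.cofMap)
    (Category.id_comp f.map)
  comp_id f := CofBif.Hom.ext (Category.comp_id f.base) (Category.comp_id f.cofMap)
    (Category.comp_id f.map)
  assoc f g h := CofBif.Hom.ext (Category.assoc f.base g.base h.base)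
    (Category.assoc f.cofMap g.cofMap h.cofMap) (Category.assoc f.map g.map h.map)

/-- The functor that forgets the choices of `Q(f)`. -/
def CofBif.toBif : M.CofBif ⥤ M.Bif where
  obj X := X.biRep
  map f := ⟨CofBif.Hom.base f, CofBif.Hom.map f, CofBif.Hom.cofMap f, CofBif.Hom.isLift f,
    CofBif.Hom.isExtension f⟩

/-- The functor that forgets the fibrant replacements. -/
def CofBif.toCof : M.CofBif ⥤ M.Cof where
  obj X := ⟨X.biRep.obj, X.biRep.rep.cof⟩
  map f := ⟨CofBif.Hom.base f, CofBif.Hom.cofMap f, CofBif.Hom.isLift f⟩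

/-- In `M.Bif` the map `Q(f)` merely exists. `M.CofBif` records it, because naturality of `QA ⟶ RQA`
refers to it. -/
instance : (CofBif.toBif M).Full where
  map_surjective f := by
    obtain ⟨h, hh, hk⟩ := f.isLift
    exact ⟨⟨f.base, h, f.map, hh, hk⟩, rfl⟩

instance : (CofBif.toBif M).EssSurj where
  mem_essImage X := ⟨⟨X⟩, ⟨Iso.refl _⟩⟩

/-- The natural map `QA ⟶ RQA`. -/
def CofBif.j : CofBif.toCof M ⋙ Cof.cofibrant M ⟶ CofBif.toBif M ⋙ Bif.cofibrant M where
  app X := M.Q.homMk X.biRep.rep.fib.j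
  naturality X Y f := by
    apply M.Q.hom_ext
    exact (CofBif.Hom.isExtension f).symm

end AbelianModelStructure

/-! ### Construction of `Tor` for cofibrant objects, then for all objects -/

section

open AbelianModelStructure

variable {𝒜 : Type u} [Category.{v} 𝒜] [Abelian 𝒜] [HasExt.{w} 𝒜]
variable {𝒜' : Type u'} [Category.{v'} 𝒜'] [Abelian 𝒜'] [HasExt.{w'} 𝒜']
variable (M : AbelianModelStructure 𝒜) (M' : AbelianModelStructure 𝒜')
variable (T : 𝒜 ⥤ 𝒜' ⥤ AddCommGrpCat.{t}) [IsTensorProduct T]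

/-- The bifunctor `τ` of cofibrant objects is `Torₙ`. -/
structure IsTorOnCof (n : ℤ)
    (τ : M.Q.FullSubcategory ⥤ M'.Q.FullSubcategory ⥤ AddCommGrpCat.{t}) : Prop where
  left : Nonempty (precomp₂ τ (Resolved.base M M.Q.ι) (𝟭 _) ≅
    precomp₂ (lTor T n) (Resolved.complex M M.Q.ι) M'.Q.ι)
  right : Nonempty (precomp₂ τ (𝟭 _) (Resolved.base M' M'.Q.ι) ≅
    precomp₂ (rTor T n) M.Q.ι (Resolved.complex M' M'.Q.ι))

variable {M M' T}

lemma IsTorOnCof.flip {n : ℤ}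
    {τ : M.Q.FullSubcategory ⥤ M'.Q.FullSubcategory ⥤ AddCommGrpCat.{t}}
    (h : IsTorOnCof M M' T n τ) : IsTorOnCof M' M T.flip n τ.flip where
  left := h.right.map flipIso
  right := h.left.map flipIso

lemma IsTorCof.flip {n : ℤ} {F : 𝒜 ⥤ 𝒜' ⥤ AddCommGrpCat.{t}}
    (h : IsTorCof M M' T n F) : IsTorCof M' M T.flip n F.flip where
  left := h.right.map flipIso
  right := h.left.map flipIso

lemma IsTorCof.of_iso {n : ℤ} {F G : 𝒜 ⥤ 𝒜' ⥤ AddCommGrpCat.{t}} (h : IsTorCof M M' T n F)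
    (e : F ≅ G) : IsTorCof M M' T n G where
  left := h.left.map fun i => (precomp₂Iso e _ _).symm ≪≫ i
  right := h.right.map fun i => (precomp₂Iso e _ _).symm ≪≫ i

/-- By uniqueness, statements invariant under isomorphism need proof for one such bifunctor only. -/
lemma IsTorHo.nonempty_iso {n : ℤ} {F G : 𝒜 ⥤ 𝒜' ⥤ AddCommGrpCat.{t}} (hF : IsTorHo M M' T n F)
    (hG : IsTorHo M M' T n G) : Nonempty (F ≅ G) := by
  obtain ⟨i⟩ := hF.left
  obtain ⟨k⟩ := hG.left
  exact nonempty_iso_of_precomp₂ _ _ (i ≪≫ k.symm)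

lemma isTorCof_of_iso {n : ℤ} {F : 𝒜 ⥤ 𝒜' ⥤ AddCommGrpCat.{t}}
    {τ : M.Q.FullSubcategory ⥤ M'.Q.FullSubcategory ⥤ AddCommGrpCat.{t}}
    (hτ : IsTorOnCof M M' T n τ) (e : precomp₂ F (Cof.base M) (Cof.base M') ≅
      precomp₂ τ (Cof.cofibrant M) (Cof.cofibrant M')) : IsTorCof M M' T n F where
  left := hτ.left.map fun i =>
    precomp₂Iso e (Resolved.base M (Cof.replacement M)) (𝟭 _) ≪≫
      precomp₂Iso i (Resolved.toCofibrant (Cof.replacement M) fun X => X.rep.cofibrant)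
        (Cof.cofibrant M')
  right := hτ.right.map fun i =>
    precomp₂Iso e (𝟭 _) (Resolved.base M' (Cof.replacement M')) ≪≫
      precomp₂Iso i (Cof.cofibrant M)
        (Resolved.toCofibrant (Cof.replacement M') fun X => X.rep.cofibrant)

lemma isTorHo_of_iso {n : ℤ} {F : 𝒜 ⥤ 𝒜' ⥤ AddCommGrpCat.{t}}
    {τ : M.Q.FullSubcategory ⥤ M'.Q.FullSubcategory ⥤ AddCommGrpCat.{t}}
    (hτ : IsTorOnCof M M' T n τ) (e : precomp₂ F (Bif.base M) (Bif.base M') ≅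
      precomp₂ τ (Bif.cofibrant M) (Bif.cofibrant M')) : IsTorHo M M' T n F where
  left := hτ.left.map fun i =>
    precomp₂Iso e (Resolved.base M (Bif.replacement M)) (𝟭 _) ≪≫
      precomp₂Iso i (Resolved.toCofibrant (Bif.replacement M) fun X => X.rep.cofibrant)
        (Bif.cofibrant M')
  right := hτ.right.map fun i =>
    precomp₂Iso e (𝟭 _) (Resolved.base M' (Bif.replacement M')) ≪≫
      precomp₂Iso i (Bif.cofibrant M)
        (Resolved.toCofibrant (Bif.replacement M') fun X => X.rep.cofibrant)

/-- Each side of the balance isomorphism shows that the other does not depend on its resolutions and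
chain maps. -/
lemma exists_isTorOnCof (hflat : ∀ A : 𝒜, M.trivCof A → IsFlat T A)
    (hflat' : ∀ B : 𝒜', M'.trivCof B → IsFlat' T B) (n : ℤ) :
    ∃ τ, IsTorOnCof M M' T n τ := by
  obtain ⟨i⟩ := nonempty_lTor_iso_rTor T (Resolved.complex M M.Q.ι) (Resolved.complex M' M'.Q.ι)
    (fun X => X.res.acyclic) (fun X => X.res.acyclic)
    (fun X k => hflat _ (X.res.trivCof_X X.obj.property k))
    (fun X k => hflat' _ (X.res.trivCof_X X.obj.property k)) n
  obtain ⟨τ, h, h'⟩ := exists_descent_of_balanced (Resolved.base M M.Q.ι) (Resolved.base M' M'.Q.ι)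
    (precomp₂ (lTor T n) (Resolved.complex M M.Q.ι) M'.Q.ι)
    (precomp₂ (rTor T n) M.Q.ι (Resolved.complex M' M'.Q.ι))
    (precomp₂ArgIso (lTor T n) (Iso.refl _) (Resolved.opcyclesIso (M := M') M'.Q.ι).symm ≪≫ i ≪≫
      precomp₂ArgIso (rTor T n) (Resolved.opcyclesIso (M := M) M.Q.ι) (Iso.refl _))
  exact ⟨τ, h, h'⟩

section

variable {n : ℤ} {τ : M.Q.FullSubcategory ⥤ M'.Q.FullSubcategory ⥤ AddCommGrpCat.{t}}
  (hτ : IsTorOnCof M M' T n τ)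

include hτ

/-- `Torₙ(A, -)` on cofibrant objects is the homology of the tensor product with a resolution. -/
lemma IsTorOnCof.exists_iso (A : M.Q.FullSubcategory) :
    ∃ W : M.Resolution A.obj, Nonempty (τ.obj A ≅ M'.Q.ι ⋙ (lTor T n).obj W.complex) := by
  obtain ⟨W⟩ := M.nonempty_resolution A.obj
  obtain ⟨i⟩ := hτ.left
  exact ⟨W, ⟨i.app ⟨A, W⟩⟩⟩

/-- The cokernel of `QB ⟶ RQB` is trivially cofibrant, hence flat, so its `Tor` vanishes in all
degrees. -/
lemma IsTorOnCof.isIso_j_right (hflat : ∀ A : 𝒜, M.trivCof A → IsFlat T A)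
    (hflat' : ∀ B : 𝒜', M'.trivCof B → IsFlat' T B) (A : M.Q.FullSubcategory) (Y : M'.CofBif) :
    IsIso ((τ.obj A).map ((CofBif.j M').app Y)) := by
  obtain ⟨W, ⟨i⟩⟩ := hτ.exists_iso A
  rw [NatIso.isIso_map_iff i]
  exact (lTorLongExactSequences fun k => hflat _ (W.trivCof_X A.property k)).isIso_map_f
    Y.biRep.rep.fib.shortExact
    (fun k => isZero_lTor W.acyclic (hflat' _ Y.biRep.rep.fib.trivCof) k) n

/-- `Torₙ(A, QB)` depends on the choice of maps `Q(f)` only through `f`. -/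
lemma IsTorOnCof.map_eq_right (hflat' : ∀ B : 𝒜', M'.trivCof B → IsFlat' T B)
    (A : M.Q.FullSubcategory) {X Y : M'.Cof} (f g : X ⟶ Y)
    (h : (Cof.base M').map f = (Cof.base M').map g) :
    (τ.obj A).map ((Cof.cofibrant M').map f) = (τ.obj A).map ((Cof.cofibrant M').map g) := by
  obtain ⟨W, ⟨i⟩⟩ := hτ.exists_iso A
  rw [← cancel_mono (i.hom.app _), i.hom.naturality, i.hom.naturality]
  congr 1
  change ((lTor T n).obj W.complex).map (Cof.Hom.map f) =
    ((lTor T n).obj W.complex).map (Cof.Hom.map g)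
  -- The difference of two lifts maps a cofibrant object into a trivially fibrant kernel. So it
  -- factors through the core, whose objects are flat and have vanishing homology with `W`.
  rw [← sub_eq_zero, ← Functor.map_sub]
  have hz : (Cof.Hom.map f - Cof.Hom.map g) ≫ Y.rep.p = 0 := by
    have hf : Cof.Hom.map f ≫ Y.rep.p = X.rep.p ≫ Cof.Hom.base f := Cof.Hom.isLift f
    have hg : Cof.Hom.map g ≫ Y.rep.p = X.rep.p ≫ Cof.Hom.base g := Cof.Hom.isLift g
    have h : Cof.Hom.base f = Cof.Hom.base g := h
    rw [Preadditive.sub_comp, hf, hg, h, sub_self]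
  have := Y.rep.shortExact.mono_f
  obtain ⟨O, hO, a, b, hab⟩ := M'.exists_core_of_trivFib X.rep.cofibrant Y.rep.trivFib
    (Y.rep.shortExact.exact.lift _ hz)
  have hd := Y.rep.shortExact.exact.lift_f _ hz
  rw [← hd, ← hab, Category.assoc, Functor.map_comp,
    (isZero_lTor W.acyclic (hflat' O ⟨hO.1, hO.2.1⟩) n).eq_of_tgt
      (((lTor T n).obj W.complex).map a) 0, zero_comp]

end

/-- The functors `Torₙ` of the homotopy category exist, and are computed by cofibrant
replacements. -/
lemma exists_isTorHo (hflat : ∀ A : 𝒜, M.trivCof A → IsFlat T A)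
    (hflat' : ∀ B : 𝒜', M'.trivCof B → IsFlat' T B) (n : ℤ) :
    ∃ F, IsTorHo M M' T n F ∧ IsTorCof M M' T n F := by
  obtain ⟨τ, hτ⟩ := exists_isTorOnCof hflat hflat' n
  obtain ⟨F, ⟨e⟩⟩ := exists_descent₂ (Cof.base M) (Cof.base M')
    (precomp₂ τ (Cof.cofibrant M) (Cof.cofibrant M'))
    (fun f g Z h => hτ.flip.map_eq_right hflat _ f g h)
    (fun f g Z h => hτ.map_eq_right hflat' _ f g h)
  refine ⟨F, isTorHo_of_iso hτ ?_, isTorCof_of_iso hτ e⟩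
  -- `QA ⟶ RQA` in the first variable, then in the second; both become isomorphisms on `Tor`.
  let a := mapL τ (CofBif.j M) (CofBif.toCof M' ⋙ Cof.cofibrant M')
  let b := mapR τ (CofBif.toBif M ⋙ Bif.cofibrant M) (CofBif.j M')
  have ha : IsIso a := by
    have : ∀ X, IsIso (a.app X) := fun X => by
      have : ∀ Y, IsIso ((a.app X).app Y) := fun Y =>
        hτ.flip.isIso_j_right hflat' hflat _ X
      exact NatIso.isIso_of_isIso_app _
    exact NatIso.isIso_of_isIso_app _
  have hb : IsIso b := by
    have : ∀ X, IsIso (b.app X) := fun X => by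
      have : ∀ Y, IsIso ((b.app X).app Y) := fun Y => hτ.isIso_j_right hflat hflat' _ Y
      exact NatIso.isIso_of_isIso_app _
    exact NatIso.isIso_of_isIso_app _
  -- The comparison is natural with `Q(f)` recorded; descent to `Bif` removes that choice.
  exact (nonempty_iso_of_precomp₂ (CofBif.toBif M) (CofBif.toBif M')
    (precomp₂Iso e (CofBif.toCof M) (CofBif.toCof M') ≪≫ asIso a ≪≫ asIso b)).some

end


/-! ## Horseshoes of cofibrant replacements -/

section

variable {𝒞 : Type u} [Category.{v} 𝒞] [Abelian 𝒞]

/-- The nine lemma: three short exact columns and two short exact rows make the first row exact. -/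
lemma shortExact_first_row {V₁ V₂ V₃ : ShortComplex 𝒞} (φ : V₁ ⟶ V₂) (ψ : V₂ ⟶ V₃)
    (h₁ : V₁.ShortExact) (h₂ : V₂.ShortExact) (h₃ : V₃.ShortExact) (z₁ : φ.τ₁ ≫ ψ.τ₁ = 0)
    {z₂ : φ.τ₂ ≫ ψ.τ₂ = 0} (hm : (ShortComplex.mk _ _ z₂).ShortExact)
    {z₃ : φ.τ₃ ≫ ψ.τ₃ = 0} (hl : (ShortComplex.mk _ _ z₃).ShortExact) :
    (ShortComplex.mk _ _ z₁).ShortExact := by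
  have mono₁ : Mono V₁.f := h₁.mono_f
  have mono₂ : Mono V₂.f := h₂.mono_f
  have mono₃ : Mono V₃.f := h₃.mono_f
  have epi₁ : Epi V₁.g := h₁.epi_g
  have monof : Mono φ.τ₂ := hm.mono_f
  have epig : Epi ψ.τ₂ := hm.epi_g
  have monof' : Mono φ.τ₃ := hl.mono_f
  have hmono : Mono φ.τ₁ := by
    have : Mono (φ.τ₁ ≫ V₂.f) := by
      rw [φ.comm₁₂]
      infer_instance
    exact mono_of_mono φ.τ₁ V₂.f
  have hepi : Epi ψ.τ₁ := by
    rw [epi_iff_surjective_up_to_refinements]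
    intro A a
    -- The lift `x` need not lie in `V₂.X₁`. Its image in `V₂.X₃` comes from `V₁.X₃`, and
    -- subtracting a preimage from `V₁.X₂` corrects it without changing its image under `ψ.τ₂`.
    obtain ⟨A₁, π₁, _, x, hx⟩ := surjective_up_to_refinements_of_epi ψ.τ₂ (a ≫ V₃.f)
    have hx' : (x ≫ V₂.g) ≫ ψ.τ₃ = 0 := by
      rw [Category.assoc, ← ψ.comm₂₃, ← reassoc_of% hx, V₃.zero, comp_zero, comp_zero]
    obtain ⟨y, hy⟩ : ∃ y, y ≫ φ.τ₃ = x ≫ V₂.g :=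
      ⟨hl.exact.lift _ hx', hl.exact.lift_f _ hx'⟩
    obtain ⟨A₂, π₂, _, z, hz⟩ := surjective_up_to_refinements_of_epi V₁.g y
    have hk : (π₂ ≫ x - z ≫ φ.τ₂) ≫ V₂.g = 0 := by
      rw [Preadditive.sub_comp, Category.assoc, Category.assoc, φ.comm₂₃, ← hy,
        reassoc_of% hz, sub_self]
    refine ⟨A₂, π₂ ≫ π₁, inferInstance, h₂.exact.lift _ hk, ?_⟩
    rw [← cancel_mono V₃.f, Category.assoc, Category.assoc, Category.assoc, hx, ψ.comm₁₂,
      reassoc_of% (h₂.exact.lift_f _ hk), Preadditive.sub_comp, Category.assoc, Category.assoc,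
      z₂, comp_zero, sub_zero]
  have hexact : (ShortComplex.mk _ _ z₁).Exact := by
    rw [ShortComplex.exact_iff_exact_up_to_refinements]
    intro A (x : A ⟶ V₂.X₁) (hx : x ≫ ψ.τ₁ = 0)
    have hx' : (x ≫ V₂.f) ≫ ψ.τ₂ = 0 := by
      rw [Category.assoc, ← ψ.comm₁₂, reassoc_of% hx, zero_comp]
    obtain ⟨y, hy⟩ : ∃ y : A ⟶ V₁.X₂, y ≫ φ.τ₂ = x ≫ V₂.f :=
      ⟨hm.exact.lift _ hx', hm.exact.lift_f _ hx'⟩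
    have hy' : y ≫ V₁.g = 0 := by
      rw [← cancel_mono φ.τ₃, Category.assoc, ← φ.comm₂₃, reassoc_of% hy, V₂.zero,
        comp_zero, zero_comp]
    refine ⟨A, 𝟙 A, inferInstance, h₁.exact.lift y hy', ?_⟩
    change 𝟙 A ≫ x = h₁.exact.lift y hy' ≫ φ.τ₁
    rw [← cancel_mono V₂.f, Category.id_comp, Category.assoc, φ.comm₁₂,
      h₁.exact.lift_f_assoc, hy]
  exact ShortComplex.ShortExact.mk' hexact hmono hepi

end

namespace AbelianModelStructure

variable {𝒞 : Type u} [Category.{v} 𝒞] [Abelian 𝒞] [HasExt.{w} 𝒞] (M : AbelianModelStructure 𝒞)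

/-- A short exact sequence of cofibrant replacements of the terms of a short complex. -/
structure Horseshoe (S : ShortComplex 𝒞) where
  rep₁ : M.CofibrantReplacement S.X₁
  rep₂ : M.CofibrantReplacement S.X₂
  rep₃ : M.CofibrantReplacement S.X₃
  f : rep₁.Q ⟶ rep₂.Q
  g : rep₂.Q ⟶ rep₃.Q
  zero : f ≫ g = 0
  shortExact : (ShortComplex.mk f g zero).ShortExact
  isLift_f : rep₁.IsLift rep₂ S.f f
  isLift_g : rep₂.IsLift rep₃ S.g g

variable {M}

/-- The short exact sequence `0 ⟶ K ⟶ QA ⟶ A ⟶ 0`. -/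
abbrev CofibrantReplacement.seq {A : 𝒞} (a : M.CofibrantReplacement A) : ShortComplex 𝒞 :=
  ShortComplex.mk a.i a.p a.zero

lemma CofibrantReplacement.exists_seq_hom {A B : 𝒞} {a : M.CofibrantReplacement A}
    {b : M.CofibrantReplacement B} {f : A ⟶ B} {h : a.Q ⟶ b.Q} (hh : a.IsLift b f h) :
    ∃ k : a.K ⟶ b.K, k ≫ b.i = a.i ≫ h := by
  have hh : h ≫ b.p = a.p ≫ f := hh
  have := b.shortExact.mono_f
  have hz : (a.i ≫ h) ≫ b.p = 0 := by rw [Category.assoc, hh, reassoc_of% a.zero, zero_comp]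
  exact ⟨b.shortExact.exact.lift _ hz, b.shortExact.exact.lift_f _ hz⟩

/-- The kernels of a horseshoe form a short exact sequence. -/
lemma Horseshoe.exists_kernels {S : ShortComplex 𝒞} (hS : S.ShortExact) (H : M.Horseshoe S) :
    ∃ (k : H.rep₁.K ⟶ H.rep₂.K) (l : H.rep₂.K ⟶ H.rep₃.K) (z : k ≫ l = 0),
      (ShortComplex.mk k l z).ShortExact ∧ l ≫ H.rep₃.i = H.rep₂.i ≫ H.g := by
  obtain ⟨k, hk⟩ := CofibrantReplacement.exists_seq_hom H.isLift_f
  obtain ⟨l, hl⟩ := CofibrantReplacement.exists_seq_hom H.isLift_g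
  let φ : H.rep₁.seq ⟶ H.rep₂.seq := ⟨k, H.f, S.f, hk, H.isLift_f⟩
  let ψ : H.rep₂.seq ⟶ H.rep₃.seq := ⟨l, H.g, S.g, hl, H.isLift_g⟩
  have := H.rep₃.shortExact.mono_f
  have z : k ≫ l = 0 := by
    rw [← cancel_mono H.rep₃.i, Category.assoc, hl, reassoc_of% hk, H.zero, comp_zero, zero_comp]
  exact ⟨k, l, z, shortExact_first_row φ ψ H.rep₁.shortExact H.rep₂.shortExact
    H.rep₃.shortExact z H.shortExact hS, hl⟩

/-- Morphisms of short exact sequences lift to horseshoes. -/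
lemma Horseshoe.exists_lift {S S' : ShortComplex 𝒞} (hS' : S'.ShortExact)
    (H : M.Horseshoe S) (H' : M.Horseshoe S') (φ : S ⟶ S') :
    ∃ ψ : ShortComplex.mk H.f H.g H.zero ⟶ ShortComplex.mk H'.f H'.g H'.zero,
      H.rep₁.IsLift H'.rep₁ φ.τ₁ ψ.τ₁ ∧ H.rep₃.IsLift H'.rep₃ φ.τ₃ ψ.τ₃ := by
  obtain ⟨k, l, z, hkl, hl⟩ := H'.exists_kernels hS'
  obtain ⟨a₃, ha₃⟩ := H.rep₃.exists_isLift H'.rep₃ φ.τ₃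
  obtain ⟨a₂, ha₂⟩ := H.rep₂.exists_isLift H'.rep₂ φ.τ₂
  have ha₃ : a₃ ≫ H'.rep₃.p = H.rep₃.p ≫ φ.τ₃ := ha₃
  have ha₂ : a₂ ≫ H'.rep₂.p = H.rep₂.p ≫ φ.τ₂ := ha₂
  have hf : H.f ≫ H.rep₂.p = H.rep₁.p ≫ S.f := H.isLift_f
  have hf' : H'.f ≫ H'.rep₂.p = H'.rep₁.p ≫ S'.f := H'.isLift_f
  have hg : H.g ≫ H.rep₃.p = H.rep₂.p ≫ S.g := H.isLift_g
  have hg' : H'.g ≫ H'.rep₃.p = H'.rep₂.p ≫ S'.g := H'.isLift_g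
  have := H'.rep₃.shortExact.mono_f
  have monof : Mono H'.f := H'.shortExact.mono_f
  have monoS : Mono S'.f := hS'.mono_f
  -- The lifts `a₂` and `a₃` need not commute with the rows. Their defect lands in the third kernel
  -- and lifts to the second one, since the first kernel is trivially fibrant and `H.rep₂.Q`
  -- cofibrant; that lift corrects `a₂`.
  have hd : (H.g ≫ a₃ - a₂ ≫ H'.g) ≫ H'.rep₃.p = 0 := by
    rw [Preadditive.sub_comp, Category.assoc, Category.assoc, ha₃, hg', reassoc_of% ha₂,
      φ.comm₂₃, reassoc_of% hg, sub_self]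
  obtain ⟨d, hd⟩ : ∃ d, d ≫ H'.rep₃.i = H.g ≫ a₃ - a₂ ≫ H'.g :=
    ⟨H'.rep₃.shortExact.exact.lift _ hd, H'.rep₃.shortExact.exact.lift_f _ hd⟩
  obtain ⟨c, hc⟩ : ∃ c, c ≫ l = d := exists_lift_of_ext hkl
    (M.ext_cof_trivFib H.rep₂.cofibrant H'.rep₁.trivFib) d
  let b := a₂ + c ≫ H'.rep₂.i
  have hb : b ≫ H'.g = H.g ≫ a₃ := by
    rw [Preadditive.add_comp, Category.assoc, ← hl, reassoc_of% hc, hd]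
    abel
  have hb' : b ≫ H'.rep₂.p = H.rep₂.p ≫ φ.τ₂ := by
    rw [Preadditive.add_comp, Category.assoc, H'.rep₂.zero, comp_zero, add_zero, ha₂]
  have hz : (H.f ≫ b) ≫ H'.g = 0 := by
    rw [Category.assoc, hb, reassoc_of% H.zero, zero_comp]
  obtain ⟨a₁, ha₁⟩ : ∃ a₁, a₁ ≫ H'.f = H.f ≫ b :=
    ⟨H'.shortExact.exact.lift _ hz, H'.shortExact.exact.lift_f _ hz⟩
  refine ⟨⟨a₁, b, a₃, ha₁, hb⟩, ?_, ha₃⟩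
  change a₁ ≫ H'.rep₁.p = H.rep₁.p ≫ φ.τ₁
  rw [← cancel_mono S'.f, Category.assoc, Category.assoc, ← hf', reassoc_of% ha₁, hb',
    reassoc_of% hf, φ.comm₁₂]

/-- The horseshoe lemma. -/
lemma IsHereditary.nonempty_horseshoe (hM : M.IsHereditary) {S : ShortComplex 𝒞}
    (hS : S.ShortExact) : Nonempty (M.Horseshoe S) := by
  have monoS : Mono S.f := hS.mono_f
  have epiS : Epi S.g := hS.epi_g
  obtain ⟨r₃⟩ := M.nonempty_cofibrantReplacement S.X₃
  -- A replacement of the pullback maps onto both `S.X₂` and `r₃.Q`, so it can be the middle term of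
  -- the horseshoe.
  obtain ⟨r⟩ := M.nonempty_cofibrantReplacement (pullback S.g r₃.p)
  have epi₃ : Epi r₃.p := r₃.shortExact.epi_g
  have epir : Epi r.p := r.shortExact.epi_g
  have monoi : Mono r.i := r.shortExact.mono_f
  let p₂ := r.p ≫ pullback.fst S.g r₃.p
  let g := r.p ≫ pullback.snd S.g r₃.p
  have hpg : p₂ ≫ S.g = g ≫ r₃.p := by simp [p₂, g, pullback.condition]
  have epip₂ : Epi p₂ := epi_comp _ _
  have epig : Epi g := epi_comp _ _
  have hmid : (ShortComplex.mk (kernel.ι g) g (kernel.condition g)).ShortExact :=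
    ShortComplex.ShortExact.mk' (ShortComplex.exact_kernel g) inferInstance inferInstance
  have hz₁ : (kernel.ι g ≫ p₂) ≫ S.g = 0 := by
    rw [Category.assoc, hpg, kernel.condition_assoc, zero_comp]
  obtain ⟨p₁, hp₁⟩ : ∃ p₁, p₁ ≫ S.f = kernel.ι g ≫ p₂ :=
    ⟨hS.exact.lift _ hz₁, hS.exact.lift_f _ hz₁⟩
  have hrg : r.i ≫ g = 0 := by simp only [g, reassoc_of% r.zero, zero_comp]
  let i₁ := kernel.lift g r.i hrg
  have hi₁ : i₁ ≫ kernel.ι g = r.i := kernel.lift_ι _ _ _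
  have z₁ : i₁ ≫ p₁ = 0 := by
    rw [← cancel_mono S.f, Category.assoc, hp₁, reassoc_of% hi₁, zero_comp]
    simp only [p₂, reassoc_of% r.zero, zero_comp]
  have col₁ : (ShortComplex.mk i₁ p₁ z₁).ShortExact := by
    refine ShortComplex.ShortExact.mk' ?_ ?_ ?_
    · rw [ShortComplex.exact_iff_exact_up_to_refinements]
      intro A (x : A ⟶ kernel g) (hx : x ≫ p₁ = 0)
      have hx' : (x ≫ kernel.ι g) ≫ r.p = 0 := by
        apply pullback.hom_ext
        · rw [Category.assoc, Category.assoc, ← hp₁, reassoc_of% hx, zero_comp, zero_comp]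
        · rw [Category.assoc, Category.assoc, kernel.condition, comp_zero, zero_comp]
      refine ⟨A, 𝟙 A, inferInstance, r.shortExact.exact.lift _ hx', ?_⟩
      change 𝟙 A ≫ x = r.shortExact.exact.lift _ hx' ≫ i₁
      rw [← cancel_mono (kernel.ι g), Category.id_comp, Category.assoc, hi₁]
      exact (r.shortExact.exact.lift_f _ hx').symm
    · have : Mono (i₁ ≫ kernel.ι g) := by rw [hi₁]; infer_instance
      exact mono_of_mono i₁ (kernel.ι g)
    · change Epi p₁
      rw [epi_iff_surjective_up_to_refinements]
      intro A a
      obtain ⟨A₁, π, _, x, hx⟩ := surjective_up_to_refinements_of_epi r.p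
        (pullback.lift (f := S.g) (g := r₃.p) (a ≫ S.f) 0 (by simp))
      have hx' : x ≫ g = 0 := by
        simp only [g, ← reassoc_of% hx, pullback.lift_snd, comp_zero]
      refine ⟨A₁, π, inferInstance, kernel.lift g x hx', ?_⟩
      rw [← cancel_mono S.f, Category.assoc, Category.assoc, hp₁, kernel.lift_ι_assoc]
      simp only [p₂, ← reassoc_of% hx, pullback.lift_fst]
  have col₂ : (ShortComplex.mk (kernel.ι p₂) p₂ (kernel.condition p₂)).ShortExact :=
    ShortComplex.ShortExact.mk' (ShortComplex.exact_kernel p₂) inferInstance inferInstance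
  have monoi₃ := r₃.shortExact.mono_f
  have hri : r.i ≫ p₂ = 0 := by simp only [p₂, reassoc_of% r.zero, zero_comp]
  let k := kernel.lift p₂ r.i hri
  have hk : k ≫ kernel.ι p₂ = r.i := kernel.lift_ι _ _ _
  have hkg : (kernel.ι p₂ ≫ g) ≫ r₃.p = 0 := by
    rw [Category.assoc, ← hpg, kernel.condition_assoc, zero_comp]
  obtain ⟨l, hl⟩ : ∃ l, l ≫ r₃.i = kernel.ι p₂ ≫ g :=
    ⟨r₃.shortExact.exact.lift _ hkg, r₃.shortExact.exact.lift_f _ hkg⟩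
  have hkl : k ≫ l = 0 := by
    rw [← cancel_mono r₃.i, Category.assoc, hl, reassoc_of% hk, hrg, zero_comp]
  let φ : ShortComplex.mk i₁ p₁ z₁ ⟶ ShortComplex.mk (kernel.ι p₂) p₂ (kernel.condition p₂) :=
    { τ₁ := k
      τ₂ := kernel.ι g
      τ₃ := S.f
      comm₁₂ := hk.trans hi₁.symm
      comm₂₃ := hp₁.symm }
  let ψ : ShortComplex.mk (kernel.ι p₂) p₂ (kernel.condition p₂) ⟶ r₃.seq :=
    { τ₁ := l
      τ₂ := g
      τ₃ := S.g
      comm₁₂ := hl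
      comm₂₃ := hpg.symm }
  -- The kernel of `p₂` is an extension of `r₃.K` by `r.K`, hence trivially fibrant. The kernel of
  -- `g` is cofibrant by heredity.
  have hrow := shortExact_first_row φ ψ col₁ col₂ r₃.shortExact hkl hmid hS
  exact ⟨⟨⟨_, _, i₁, p₁, z₁, col₁, hM.Q_left hmid r.cofibrant r₃.cofibrant, r.trivFib⟩,
    ⟨_, _, _, p₂, _, col₂, r.cofibrant, M.trivFib_middle hrow r.trivFib r₃.trivFib⟩, r₃,
    kernel.ι g, g, kernel.condition g, hmid, hp₁.symm, hpg.symm⟩⟩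

end AbelianModelStructure

/-! ## Functors computed by cofibrant replacements -/

/-- Exactness is invariant under isomorphisms of abelian groups. -/
lemma exact_of_iso {X Y Z X' Y' Z' : AddCommGrpCat.{t}} {f : X ⟶ Y} {g : Y ⟶ Z} {f' : X' ⟶ Y'}
    {g' : Y' ⟶ Z'} (a : X ≅ X') (b : Y ≅ Y') (c : Z ≅ Z') (h : a.hom ≫ f' = f ≫ b.hom)
    (h' : b.hom ≫ g' = g ≫ c.hom) (H : Function.Exact f' g') : Function.Exact f g := by
  have hz' : f' ≫ g' = 0 := by
    ext x
    exact H.apply_apply_eq_zero x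
  have hz : f ≫ g = 0 := by
    rw [← cancel_mono c.hom, Category.assoc, ← h', ← reassoc_of% h, hz', comp_zero, zero_comp]
  have e : ShortComplex.mk f g hz ≅ ShortComplex.mk f' g' hz' := ShortComplex.isoMk a b c h h'
  exact (ShortComplex.ab_exact_iff_function_exact _).1
    ((ShortComplex.exact_iff_of_iso e).2 ((ShortComplex.ab_exact_iff_function_exact _).2 H))

section

open AbelianModelStructure

variable {𝒞 : Type u} [Category.{v} 𝒞] [Abelian 𝒞] [HasExt.{w} 𝒞] {M : AbelianModelStructure 𝒞}
variable {h F : ℤ → 𝒞 ⥤ AddCommGrpCat.{t}}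
  (e : ∀ n, Cof.base M ⋙ F n ≅ Cof.replacement M ⋙ h n)

/-- A functor computed by cofibrant replacements, evaluated at one replacement. -/
def cofIso (n : ℤ) {A : 𝒞} (a : M.CofibrantReplacement A) : (F n).obj A ≅ (h n).obj a.Q :=
  (e n).app ⟨A, a⟩

lemma cofIso_naturality (n : ℤ) {A B : 𝒞} {a : M.CofibrantReplacement A}
    {b : M.CofibrantReplacement B} {f : A ⟶ B} {f' : a.Q ⟶ b.Q} (hf : a.IsLift b f f') :
    (cofIso e n a).hom ≫ (h n).map f' = (F n).map f ≫ (cofIso e n b).hom :=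
  ((e n).hom.naturality (X := ⟨A, a⟩) (Y := ⟨B, b⟩) (Cof.Hom.mk f f' hf)).symm

-- A sum of lifts is a lift of the sum.
include e in
lemma additive_of_cof [∀ n, (h n).Additive] (n : ℤ) : (F n).Additive where
  map_add {A B f g} := by
    obtain ⟨a⟩ := M.nonempty_cofibrantReplacement A
    obtain ⟨b⟩ := M.nonempty_cofibrantReplacement B
    obtain ⟨f', hf'⟩ := a.exists_isLift b f
    obtain ⟨g', hg'⟩ := a.exists_isLift b g
    have hfg : a.IsLift b (f + g) (f' + g') := by
      have hf' : f' ≫ b.p = a.p ≫ f := hf'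
      have hg' : g' ≫ b.p = a.p ≫ g := hg'
      change (f' + g') ≫ b.p = a.p ≫ (f + g)
      rw [Preadditive.add_comp, Preadditive.comp_add, hf', hg']
    rw [← cancel_mono (cofIso e n b).hom, Preadditive.add_comp, ← cofIso_naturality e n hf',
      ← cofIso_naturality e n hg', ← cofIso_naturality e n hfg, Functor.map_add,
      Preadditive.comp_add]

/-- Long exact sequences for functors that are computed by cofibrant replacements. -/
def longExactSequencesOfCof (hM : M.IsHereditary) (L : LongExactSequences h) :
    LongExactSequences F := by
  -- An arbitrary choice of horseshoes suffices: morphisms of short exact sequences lift to them,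
  -- and naturality of the connecting maps involves only the two outer lifts.
  let H {S : ShortComplex 𝒞} (hS : S.ShortExact) := (hM.nonempty_horseshoe hS).some
  let d {S : ShortComplex 𝒞} (hS : S.ShortExact) (n : ℤ) :
      (F n).obj S.X₃ ⟶ (F (n - 1)).obj S.X₁ :=
    (cofIso e n (H hS).rep₃).hom ≫ L.δ (H hS).shortExact n ≫ (cofIso e (n - 1) (H hS).rep₁).inv
  have hd {S : ShortComplex 𝒞} (hS : S.ShortExact) (n : ℤ) :
      (cofIso e n (H hS).rep₃).hom ≫ L.δ (H hS).shortExact n =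
        d hS n ≫ (cofIso e (n - 1) (H hS).rep₁).hom := by
    simp [d]
  clear_value d
  exact
    { δ := d
      naturality := fun {S S'} hS hS' φ n => by
        obtain ⟨ψ, h₁, h₃⟩ := (H hS).exists_lift hS' (H hS') φ
        rw [← cancel_mono (cofIso e (n - 1) (H hS').rep₁).hom, Category.assoc, Category.assoc,
          ← hd hS' n, ← cofIso_naturality e _ h₁, ← reassoc_of% (hd hS n),
          ← reassoc_of% (cofIso_naturality e _ h₃)]
        exact congrArg (fun x => (cofIso e n (H hS).rep₃).hom ≫ x)
          (L.naturality (H hS).shortExact (H hS').shortExact ψ n)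
      exact₂ := fun hS n => exact_of_iso _ _ _ (cofIso_naturality e n (H hS).isLift_f)
        (cofIso_naturality e n (H hS).isLift_g) (L.exact₂ (H hS).shortExact n)
      exact₃ := fun hS n => exact_of_iso _ _ _ (cofIso_naturality e n (H hS).isLift_g)
        (hd hS n) (L.exact₃ (H hS).shortExact n)
      exact₁ := fun hS n => exact_of_iso _ _ _ (hd hS n)
        (cofIso_naturality e (n - 1) (H hS).isLift_f) (L.exact₁ (H hS).shortExact n) }

-- By thickness, a cofibrant replacement of a trivial object is trivially cofibrant.
include e in
lemma isZero_of_cof (hz : ∀ n A, M.trivCof A → IsZero ((h n).obj A)) (n : ℤ) (A : 𝒞) (hA : M.W A) :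
    IsZero ((F n).obj A) := by
  obtain ⟨a⟩ := M.nonempty_cofibrantReplacement A
  exact (hz n a.Q ⟨a.cofibrant, M.thick.middle _ a.shortExact a.trivFib.1 hA⟩).of_iso
    ((e n).app ⟨A, a⟩)

/-- Additive functors with long exact sequences that vanish on trivial objects factor through the
homotopy category. -/
lemma exists_factorization [∀ n, (F n).Additive] (L : LongExactSequences F)
    (hz : ∀ n A, M.W A → IsZero ((F n).obj A)) (ρ : ∀ A : 𝒞, M.BifibrantReplacement A) (n : ℤ) :
    ∃ G : M.Ho ρ ⥤ AddCommGrpCat.{t}, M.γ ρ ⋙ G = F n := by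
  -- `QA ⟶ A` has a trivial kernel and `QA ⟶ RQA` a trivial cokernel, so `F n` inverts both.
  have hp (A : 𝒞) : IsIso ((F n).map (ρ A).cof.p) :=
    L.isIso_map_g (ρ A).cof.shortExact (fun k => hz k _ (ρ A).cof.trivFib.1) n
  have hj (A : 𝒞) : IsIso ((F n).map (ρ A).fib.j) :=
    L.isIso_map_f (ρ A).fib.shortExact (fun k => hz k _ (ρ A).fib.trivCof.2) n
  let i (A : 𝒞) : (F n).obj A ≅ (F n).obj (ρ A).RQ :=
    (asIso ((F n).map (ρ A).cof.p)).symm ≪≫ asIso ((F n).map (ρ A).fib.j)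
  -- Homotopic maps have the same image because `F n` vanishes on the core.
  let Φ : M.Stable ⥤ AddCommGrpCat.{t} := CategoryTheory.Quotient.lift _ (F n) (by
    rintro A B f g ⟨O, hO, a, b, hab⟩
    obtain rfl : g = f + a ≫ b := by rw [hab]; abel
    rw [Functor.map_add, Functor.map_comp, (hz n O hO.2.1).eq_of_tgt ((F n).map a) 0, zero_comp,
      add_zero])
  let G : M.Ho ρ ⥤ AddCommGrpCat.{t} :=
    { obj := fun A => (F n).obj A
      map := fun {A B} f => (i A).hom ≫ Φ.map f.hom ≫ (i B).inv
      map_id := fun A => by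
        have : Φ.map (𝟙 (M.toStable.obj (ρ A).RQ)) = 𝟙 ((F n).obj (ρ A).RQ) := Φ.map_id _
        change (i A).hom ≫ Φ.map (𝟙 (M.toStable.obj (ρ A).RQ)) ≫ (i A).inv = 𝟙 _
        rw [this]
        simp
      map_comp := fun {A B C} f g => by
        change (i A).hom ≫ Φ.map (f.hom ≫ g.hom) ≫ (i C).inv = _
        rw [Φ.map_comp, Category.assoc, Category.assoc, Category.assoc]
        exact congrArg (fun x => (i A).hom ≫ Φ.map f.hom ≫ x)
          ((i B).inv_hom_id_assoc (Φ.map g.hom ≫ (i C).inv)).symm }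
  -- `G` takes the values of `F n` on objects, so the factorization is an equality of functors
  -- rather than an isomorphism.
  refine ⟨G, CategoryTheory.Functor.ext (fun A => rfl) fun A B f => ?_⟩
  obtain ⟨k, ⟨h, hh, hk⟩, hγ⟩ : ∃ k, (ρ A).IsLift (ρ B) f k ∧
      ((M.γ ρ).map f).hom = M.toStable.map k :=
    ⟨_, ((ρ A).exists_isLift (ρ B) f).choose_spec, rfl⟩
  have hh : h ≫ (ρ B).cof.p = (ρ A).cof.p ≫ f := hh
  have hk : (ρ A).fib.j ≫ k = h ≫ (ρ B).fib.j := hk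
  have hk' : (i A).hom ≫ (F n).map k ≫ (i B).inv = (F n).map f := by
    rw [← Category.assoc, Iso.comp_inv_eq]
    simp only [i, Iso.trans_hom, Iso.symm_hom, asIso_hom, asIso_inv, Category.assoc,
      IsIso.inv_comp_eq]
    rw [← Functor.map_comp, hk, Functor.map_comp, ← Functor.map_comp_assoc, ← hh,
      Functor.map_comp_assoc, IsIso.hom_inv_id_assoc]
  change (i A).hom ≫ Φ.map ((M.γ ρ).map f).hom ≫ (i B).inv = 𝟙 _ ≫ (F n).map f ≫ 𝟙 _
  rw [hγ, Category.id_comp, Category.comp_id]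
  exact hk'

end


/-! ## Comparison with the classical `Tor` -/

section

open HomologicalComplex

variable (𝒜 : Type u) [Category.{v} 𝒜] [Abelian 𝒜]

/-- The category of objects with a chosen projective resolution; a morphism is a morphism of objects
together with a chain map that lifts it. -/
structure ProjResolved where
  obj : 𝒜
  res : ProjectiveResolution obj

namespace ProjResolved

variable {𝒜}

@[ext]
structure Hom (X Y : ProjResolved 𝒜) where
  base : X.obj ⟶ Y.obj
  map : X.res.complex ⟶ Y.res.complex
  comm : map.f 0 ≫ Y.res.π.f 0 = X.res.π.f 0 ≫ base

instance : Category (ProjResolved 𝒜) where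
  Hom := Hom
  id X := ⟨𝟙 _, 𝟙 _, (Category.id_comp _).trans (Category.comp_id (X.res.π.f 0)).symm⟩
  comp {X Y Z} f g := ⟨f.base ≫ g.base, f.map ≫ g.map, by
    rw [HomologicalComplex.comp_f, Category.assoc, g.comm]
    exact (Category.assoc _ _ _).symm.trans
      ((congrArg (fun x => x ≫ g.base) f.comm).trans (Category.assoc (X.res.π.f 0) _ _))⟩
  id_comp f := Hom.ext (Category.id_comp f.base) (Category.id_comp f.map)
  comp_id f := Hom.ext (Category.comp_id f.base) (Category.comp_id f.map)
  assoc f g h := Hom.ext (Category.assoc f.base g.base h.base) (Category.assoc f.map g.map h.map)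

variable (𝒜)

/-- The functor `(A, P) ↦ A`. -/
def base : ProjResolved 𝒜 ⥤ 𝒜 where
  obj X := X.obj
  map f := Hom.base f

/-- The functor `(A, P) ↦ P`. -/
def complex : ProjResolved 𝒜 ⥤ ChainComplex 𝒜 ℕ where
  obj X := X.res.complex
  map f := Hom.map f

instance : (base 𝒜).Full where
  map_surjective {X Y} f := ⟨Hom.mk f (ProjectiveResolution.lift f X.res Y.res)
    (ProjectiveResolution.lift_commutes_zero f X.res Y.res), rfl⟩

instance [HasProjectiveResolutions 𝒜] : (base 𝒜).EssSurj where
  mem_essImage X := ⟨⟨X, projectiveResolution X⟩, ⟨Iso.refl _⟩⟩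

/-- The resolved object as opcycles of the resolution, naturally. -/
def opcyclesIso : complex 𝒜 ⋙ opcyclesFunctor 𝒜 _ 0 ≅ base 𝒜 :=
  NatIso.ofComponents (fun X => (X.res.complex.opcyclesIsCokernel 1 0
      (by simp)).coconePointUniqueUpToIso X.res.isColimitCokernelCofork)
    (fun {X Y} f => by
      have h (X : ProjResolved 𝒜) : X.res.complex.pOpcycles 0 ≫
          ((X.res.complex.opcyclesIsCokernel 1 0 (by simp)).coconePointUniqueUpToIso
            X.res.isColimitCokernelCofork).hom = X.res.π.f 0 :=
        (X.res.complex.opcyclesIsCokernel 1 0 (by simp)).comp_coconePointUniqueUpToIso_hom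
          X.res.isColimitCokernelCofork WalkingParallelPair.one
      refine (cancel_epi (X.res.complex.pOpcycles 0)).1 ?_
      refine (p_opcyclesMap_assoc (Hom.map f) 0 _).trans ?_
      refine (congrArg (fun x => (Hom.map f).f 0 ≫ x) (h Y)).trans ((Hom.comm f).trans ?_)
      refine (congrArg (fun x => x ≫ Hom.base f) (h X).symm).trans ?_
      exact Category.assoc _ _ _)

variable {𝒜} {𝒜' : Type u'} [Category.{v'} 𝒜'] [Abelian 𝒜']
variable (T : 𝒜 ⥤ 𝒜' ⥤ AddCommGrpCat.{t}) [IsTensorProduct T] [HasProjectiveResolutions 𝒜]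

/-- The classical `Tor` is computed by projective resolutions. -/
def derivedTorIso (n : ℕ) : base 𝒜 ⋙ derivedTor T n ≅
    complex 𝒜 ⋙ homologyL T (ComplexShape.down ℕ) n :=
  NatIso.ofComponents
    (fun X => NatIso.ofComponents (fun B => X.res.isoLeftDerivedObj (T.flip.obj B) n)
      (fun {B B'} g => by
        have h := (X.res.leftDerived_app_eq (T.flip.map g) n).trans (Category.assoc _ _ _).symm
        exact (Iso.eq_comp_inv _).1 h))
    (fun {X Y} f => by
      ext B : 2
      exact ProjectiveResolution.isoLeftDerivedObj_hom_naturality (Hom.base f) X.res Y.res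
        (Hom.map f) (Hom.comm f) (T.flip.obj B) n)

end ProjResolved

end

section

open AbelianModelStructure

variable {𝒜 : Type u} [Category.{v} 𝒜] [Abelian 𝒜] [HasExt.{w} 𝒜]
variable {𝒜' : Type u'} [Category.{v'} 𝒜'] [Abelian 𝒜'] [HasExt.{w'} 𝒜']
variable {M : AbelianModelStructure 𝒜} {M' : AbelianModelStructure 𝒜'}
variable {T : 𝒜 ⥤ 𝒜' ⥤ AddCommGrpCat.{t}} [IsTensorProduct T]

/-- Projective resolutions are balanced against the nonnegative half of `𝔐'`-resolutions, and the
chosen projective resolutions are removed by descent. This requires positive degree. -/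
lemma nonempty_derivedTor_iso_rTor [EnoughProjectives 𝒜]
    (hflat : ∀ A : 𝒜, M.trivCof A → IsFlat T A)
    (hflat' : ∀ B : 𝒜', M'.trivCof B → IsFlat' T B) (m : ℕ) :
    Nonempty (precomp₂ (derivedTor T (m + 1)) (𝟭 _)
        (Resolved.base M' (Cof.replacement M') ⋙ Cof.replacement M') ≅
      precomp₂ (rTor T ((m + 1 : ℕ) : ℤ)) (𝟭 _) (Resolved.complex M' (Cof.replacement M'))) := by
  obtain ⟨i⟩ := nonempty_homologyL_iso_homologyR T (ProjResolved.complex 𝒜)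
    (Resolved.complex M' (Cof.replacement M')) (fun k => k) (fun k => (k : ℤ))
    (fun k => by simp) (fun k => by simp) (fun X k => X.res.complex_exactAt_succ k)
    (fun X k => X.res.acyclic _)
    (fun X k => hflat _ (@trivCof_projective _ _ _ _ M _ (X.res.projective k)))
    (fun X k => hflat' _ (X.res.trivCof_X X.obj.rep.cofibrant _)) m
  have i₁ : precomp₂ (derivedTor T (m + 1)) (ProjResolved.base 𝒜)
        (Resolved.base M' (Cof.replacement M') ⋙ Cof.replacement M') ≅
      precomp₂ (homologyL T (ComplexShape.down ℕ) (m + 1)) (ProjResolved.complex 𝒜)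
        (Resolved.base M' (Cof.replacement M') ⋙ Cof.replacement M') :=
    precomp₂Iso (ProjResolved.derivedTorIso T (m + 1)) (𝟭 _) _
  have i₂ := precomp₂ArgIso (homologyL T (ComplexShape.down ℕ) (m + 1))
    (Iso.refl (ProjResolved.complex 𝒜))
    (Resolved.opcyclesIso (M := M') (Cof.replacement M')).symm
  have i₃ := precomp₂ArgIso (homologyR T (ComplexShape.down ℤ) ((m + 1 : ℕ) : ℤ))
    (ProjResolved.opcyclesIso 𝒜) (Iso.refl (Resolved.complex M' (Cof.replacement M')))
  exact nonempty_iso_of_comp (ProjResolved.base 𝒜) (i₁ ≪≫ i₂ ≪≫ i ≪≫ i₃)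

lemma IsTorCof.nonempty_iso_derivedTor [EnoughProjectives 𝒜]
    (hflat : ∀ A : 𝒜, M.trivCof A → IsFlat T A)
    (hflat' : ∀ B : 𝒜', M'.trivCof B → IsFlat' T B) {n : ℕ} (hn : 1 ≤ n)
    {F : 𝒜 ⥤ 𝒜' ⥤ AddCommGrpCat.{t}} (hF : IsTorCof M M' T n F) :
    Nonempty (precomp₂ F (Cof.base M) (Cof.base M') ≅
      precomp₂ (derivedTor T n) (Cof.replacement M) (Cof.replacement M')) := by
  obtain ⟨m, rfl⟩ : ∃ m, n = m + 1 := ⟨n - 1, by omega⟩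
  obtain ⟨i⟩ := nonempty_derivedTor_iso_rTor hflat hflat' m
  obtain ⟨k⟩ := hF.right
  exact nonempty_iso_of_comp_flip (Resolved.base M' (Cof.replacement M'))
    (k ≪≫ (precomp₂Iso i (Cof.replacement M) (𝟭 _)).symm)

/-! ## Properties in the second variable -/

variable {F : ℤ → 𝒜 ⥤ 𝒜' ⥤ AddCommGrpCat.{t}}

lemma nonempty_cof_iso (hF : ∀ n, IsTorCof M M' T n (F n)) (A : 𝒜) :
    ∃ (a : M.CofibrantReplacement A) (W : M.Resolution a.Q), Nonempty (∀ n,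
      Cof.base M' ⋙ (F n).obj A ≅ Cof.replacement M' ⋙ (lTor T n).obj W.complex) := by
  obtain ⟨a⟩ := M.nonempty_cofibrantReplacement A
  obtain ⟨W⟩ := M.nonempty_resolution a.Q
  exact ⟨a, W, ⟨fun n => (hF n).left.some.app ⟨⟨A, a⟩, W⟩⟩⟩

/-- For a fixed resolution `W` of a cofibrant replacement of `A`, everything follows from `Hₙ(W ⊗
-)` on cofibrant objects. -/
lemma properties_right (hM' : M'.IsHereditary) (hflat : ∀ A : 𝒜, M.trivCof A → IsFlat T A)
    (hflat' : ∀ B : 𝒜', M'.trivCof B → IsFlat' T B) (hF : ∀ n, IsTorCof M M' T n (F n))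
    (A : 𝒜) :
    (∀ n, ((F n).obj A).Additive) ∧
    Nonempty (LongExactSequences fun n => (F n).obj A) ∧
    ∀ (ρ' : ∀ B : 𝒜', M'.BifibrantReplacement B) (n : ℤ),
      ∃ G : M'.Ho ρ' ⥤ AddCommGrpCat.{t}, M'.γ ρ' ⋙ G = (F n).obj A := by
  obtain ⟨a, W, ⟨e⟩⟩ := nonempty_cof_iso hF A
  have hadd : ∀ n, ((F n).obj A).Additive :=
    additive_of_cof (F := fun n => (F n).obj A) (h := fun n => (lTor T n).obj W.complex) e
  let L : LongExactSequences fun n => (F n).obj A := longExactSequencesOfCof e hM'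
    (lTorLongExactSequences fun k => hflat _ (W.trivCof_X a.cofibrant k))
  exact ⟨hadd, ⟨L⟩, exists_factorization L (isZero_of_cof e fun n B hB =>
    isZero_lTor W.acyclic (hflat' B hB) n)⟩

end

end HoTor

end

/-! ### The main theorem -/

theorem mainTheorem9
    {𝒜 : Type u} [Category.{v} 𝒜] [Abelian 𝒜] [HasExt.{w} 𝒜]
    {𝒜' : Type u'} [Category.{v'} 𝒜'] [Abelian 𝒜'] [HasExt.{w'} 𝒜']
    (M : HoTor.AbelianModelStructure 𝒜) (hM : M.IsHereditary)
    (M' : HoTor.AbelianModelStructure 𝒜') (hM' : M'.IsHereditary)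
    (T : 𝒜 ⥤ 𝒜' ⥤ AddCommGrpCat.{t}) [HoTor.IsTensorProduct T]
    (hflat : ∀ A : 𝒜, M.trivCof A → HoTor.IsFlat T A)
    (hflat' : ∀ B : 𝒜', M'.trivCof B → HoTor.IsFlat' T B) :
    -- the groups `Torₙ(RQA, RQB)` define a bifunctor
    (∃ TorHo : ℤ → 𝒜 ⥤ 𝒜' ⥤ AddCommGrpCat.{t}, ∀ n, HoTor.IsTorHo M M' T n (TorHo n)) ∧
    ∀ TorHo : ℤ → 𝒜 ⥤ 𝒜' ⥤ AddCommGrpCat.{t}, (∀ n, HoTor.IsTorHo M M' T n (TorHo n)) →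
      -- properties in the second variable
      (∀ A : 𝒜,
        (∀ n, ((TorHo n).obj A).Additive) ∧
        Nonempty (HoTor.LongExactSequences fun n => (TorHo n).obj A) ∧
        ∀ (ρ' : ∀ B : 𝒜', M'.BifibrantReplacement B) (n : ℤ),
          ∃ G : M'.Ho ρ' ⥤ AddCommGrpCat.{t}, M'.γ ρ' ⋙ G = (TorHo n).obj A) ∧
      -- properties in the first variable
      (∀ B : 𝒜',
        (∀ n, ((TorHo n).flip.obj B).Additive) ∧
        Nonempty (HoTor.LongExactSequences fun n => (TorHo n).flip.obj B) ∧
        ∀ (ρ : ∀ A : 𝒜, M.BifibrantReplacement A) (n : ℤ),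
          ∃ G : M.Ho ρ ⥤ AddCommGrpCat.{t}, M.γ ρ ⋙ G = (TorHo n).flip.obj B) ∧
      -- cofibrant replacements suffice
      (∀ n, HoTor.IsTorCof M M' T n (TorHo n)) ∧
      -- comparison with classical Tor
      (∀ [EnoughProjectives 𝒜] [EnoughProjectives 𝒜'] (n : ℕ), 1 ≤ n →
        Nonempty
          (HoTor.precomp₂ (TorHo n) (HoTor.AbelianModelStructure.Cof.base M)
              (HoTor.AbelianModelStructure.Cof.base M') ≅
            HoTor.precomp₂ (HoTor.derivedTor T n) (HoTor.AbelianModelStructure.Cof.replacement M)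
              (HoTor.AbelianModelStructure.Cof.replacement M')) ∧
        Nonempty
          (HoTor.precomp₂ (TorHo n) (HoTor.AbelianModelStructure.Cof.base M)
              (HoTor.AbelianModelStructure.Cof.base M') ≅
            HoTor.precomp₂ (HoTor.derivedTor' T n) (HoTor.AbelianModelStructure.Cof.replacement M)
              (HoTor.AbelianModelStructure.Cof.replacement M'))) := by
  choose F hF hF' using fun n : ℤ => HoTor.exists_isTorHo hflat hflat' n
  refine ⟨⟨F, hF⟩, fun TorHo hT => ?_⟩
  -- Uniqueness carries the description by cofibrant replacements from the constructed bifunctor to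
  -- the given one.
  have hC : ∀ n, HoTor.IsTorCof M M' T n (TorHo n) := fun n =>
    (hF' n).of_iso ((hF n).nonempty_iso (hT n)).some
  refine ⟨HoTor.properties_right hM' hflat hflat' hC,
    -- The first variable is the second variable of `T.flip`, with the two flatness hypotheses
    -- exchanged.
    HoTor.properties_right hM hflat' hflat fun n => (hC n).flip, hC, fun n hn => ⟨?_, ?_⟩⟩
  · exact (hC n).nonempty_iso_derivedTor hflat hflat' hn
  · obtain ⟨i⟩ := (hC n).flip.nonempty_iso_derivedTor hflat' hflat hn
    exact ⟨HoTor.flipIso i⟩
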